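/- **Theorem 4.3 (exponential stability in the deterministic case).** Let $n\ge 2$, let $\mathcal O\subset\mathbb R^n$ be a nonempty bounded open set (for instance a bounded domain with smooth boundary), and let $\mu,\beta>0$, $r\ge 3$. Let $\mathcal V$ be the space of divergence-free fields in $C_0^\infty(\mathcal O;\mathbb R^n)$, and let $\mathbb H$, $\mathbb V$, $\widetilde{\mathbb L}^{r+1}$ be its closures in $L^2(\mathcal O;\mathbb R^n)$, $H^1_0(\mathcal O;\mathbb R^n)$ and $L^{r+1}(\mathcal O;\mathbb R^n)$. Define $$\langle \mathrm A u,v\rangle=\int_{\mathcal O}\nabla u:\nabla v\,dx,\quad \langle \mathrm B(u),v\rangle=\int_{\mathcal O}(u\cdot\nabla)u\cdot v\,dx,\quad \langle\mathcal C(u),v\rangle=\int_{\mathcal O}|u|^{r-1}u\cdot v\,dx$$ for $u,v\in\mathbb V\cap\widetilde{\mathbb L}^{r+1}$, and let $\lambda_1>0$ be the smallest eigenvalue of the Stokes operator, i.e. the smallest $\lambda$ for which some $0\neq e\in\mathbb V$ satisfies $\langle \mathrm A e,v\rangle=\lambda (e,v)_{\mathbb H}$ for all $v\in\mathbb V$.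 Put $$\eta=\frac{r-3}{2\mu(r-1)}\Big(\frac{2}{\beta\mu(r-1)}\Big)^{\frac{2}{r-3}}\ \text{ if } r>3,\qquad \eta=0\ \text{ if } r=3,$$ and assume $$\mu>\frac{2\eta}{\lambda_1}\ \text{ if } r>3,\qquad \mu\ge\frac1{2\beta}\ \text{ if } r=3 .$$ Let $f\in\mathbb V'$ and let $u_\infty\in\mathbb V\cap\widetilde{\mathbb L}^{r+1}$ be a stationary solution, that is, $$\langle\mu \mathrm A u_\infty+\mathrm B(u_\infty)+\beta\,\mathcal C(u_\infty),v\rangle=\langle f,v\rangle\quad\text{for all } v\in\mathbb V\cap\widetilde{\mathbb L}^{r+1}.$$ For $u_0\in\mathbb H$, a weak solution of the deterministic CBF equations with initial value $u_0$ is a function $u\in C([0,\infty);\mathbb H)$ with $u(0)=u_0$ which for every $T>0$ belongs to $L^2(0,T;\mathbb V)\cap L^{r+1}(0,T;\widetilde{\mathbb L}^{r+1})$ and satisfies, for all $v\in\mathbb V\cap\widetilde{\mathbb L}^{r+1}$ and $t\ge0$, $$(u(t),v)_{\mathbb H}+\int_0^t\langle \mu \mathrm A u(s)+\mathrm B(u(s))+\beta\,\mathcal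 C(u(s)),v\rangle\,ds=(u_0,v)_{\mathbb H}+t\,\langle f,v\rangle .$$ Then $\kappa:=\lambda_1\mu-2\eta>0$, and for every $u_0\in\mathbb H$ and every weak solution $u$ with $u(0)=u_0$, $$\|u(t)-u_\infty\|_{\mathbb H}^2\le e^{-\kappa t}\,\|u_0-u_\infty\|_{\mathbb H}^2\quad\text{for all } t\ge0,\qquad u(t)\to u_\infty\ \text{ in }\mathbb H\ \text{ as } t\to\infty .$$ In particular $u_\infty$ is exponentially stable in $\mathbb H$: there is $\kappa'>0$ such that $\|u(t)-u_\infty\|_{\mathbb H}\le e^{-\kappa' t}\|u_0-u_\infty\|_{\mathbb H}$ for all $t\ge 0$ and all such $u_0$ and $u$. -/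

import Mathlib

open MeasureTheory Filter Topology
open scoped ContDiff ENNReal

noncomputable section

/-- `𝕃^p(O) = L^p(O; ℝⁿ)`. -/
abbrev VecLp {n : ℕ} (O : Set (EuclideanSpace ℝ (Fin n))) (p : ℝ≥0∞) : Type :=
  Lp (EuclideanSpace ℝ (Fin n)) p (volume.restrict O)

/-- The divergence-free test fields `φ ∈ C₀^∞(O; ℝⁿ)`, `∇ · φ = 0`. -/
structure IsTestField {n : ℕ} (O : Set (EuclideanSpace ℝ (Fin n)))
    (φ : EuclideanSpace ℝ (Fin n) → EuclideanSpace ℝ (Fin n)) : Prop where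
  smooth : ContDiff ℝ ∞ φ
  compactSupport : HasCompactSupport φ
  support_subset : tsupport φ ⊆ O
  div_eq_zero : ∀ x, ∑ i, (fderiv ℝ φ x (EuclideanSpace.single i 1)) i = 0

/-- The closure of the divergence-free test fields in `L^p(O; ℝⁿ)`. The test fields already form
a linear space, so that the span adds nothing to them. -/
def solenoidalLp {n : ℕ} (O : Set (EuclideanSpace ℝ (Fin n))) (p : ℝ≥0∞) [Fact (1 ≤ p)] :
    Submodule ℝ (VecLp O p) :=
  (Submodule.span ℝ {x : VecLp O p | ∃ φ, IsTestField O φ ∧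
    x =ᵐ[volume.restrict O] φ}).topologicalClosure

/-- The space `ℍ`: closure of the divergence-free test fields in `L²(O; ℝⁿ)`. -/
abbrev spaceH {n : ℕ} (O : Set (EuclideanSpace ℝ (Fin n))) : Submodule ℝ (VecLp O 2) :=
  solenoidalLp O 2

/-- The exponent `r + 1` (for `r ≥ 0`). -/
abbrev absorptionExp (r : ℝ) : ℝ≥0∞ := 1 + ENNReal.ofReal r

instance (r : ℝ) : Fact (1 ≤ absorptionExp r) := ⟨le_self_add⟩

/-- The space `L̃^{r+1}`: closure of the divergence-free test fields in `L^{r+1}(O; ℝⁿ)`. -/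
abbrev spaceLtilde {n : ℕ} (O : Set (EuclideanSpace ℝ (Fin n))) (r : ℝ) :
    Submodule ℝ (VecLp O (absorptionExp r)) :=
  solenoidalLp O (absorptionExp r)

/-- The ambient space of pairs `(u, (∂₁u, …, ∂ₙu)) ∈ L² × (L²)ⁿ`, whose Hilbert norm is the
`H¹`-norm `(‖u‖² + ∑ᵢ ‖∂ᵢu‖²)^{1/2}`. -/
abbrev SobolevPair {n : ℕ} (O : Set (EuclideanSpace ℝ (Fin n))) : Type :=
  WithLp 2 (VecLp O 2 × PiLp 2 (fun _ : Fin n => VecLp O 2))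

/-- The space `𝕍`: closure of the divergence-free test fields in `H¹₀(O; ℝⁿ)` (that is, in the
`H¹`-norm). An element is stored together with its weak partial derivatives: `u.fst` is the
function itself and `u.snd i` is `∂ᵢu`. -/
def sobolevV {n : ℕ} (O : Set (EuclideanSpace ℝ (Fin n))) : Submodule ℝ (SobolevPair O) :=
  (Submodule.span ℝ {x : SobolevPair O | ∃ φ, IsTestField O φ ∧
    x.fst =ᵐ[volume.restrict O] φ ∧
    ∀ i, x.snd i =ᵐ[volume.restrict O]
      fun y => fderiv ℝ φ y (EuclideanSpace.single i 1)}).topologicalClosure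

/-- `𝕍` as a normed space. -/
abbrev SpaceV {n : ℕ} (O : Set (EuclideanSpace ℝ (Fin n))) : Type := sobolevV O

namespace SpaceV

variable {n : ℕ} {O : Set (EuclideanSpace ℝ (Fin n))}

/-- The element of `𝕍` as a function in `L²(O; ℝⁿ)`. -/
def val (u : SpaceV O) : VecLp O 2 := (u : SobolevPair O).fst

/-- The weak partial derivative `∂ᵢu`. -/
def grad (u : SpaceV O) (i : Fin n) : VecLp O 2 := (u : SobolevPair O).snd i

/-- `u ∈ 𝕍` also belongs to `L̃^{r+1}`. -/
def MemLtilde (r : ℝ) (u : SpaceV O) : Prop :=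
  ∃ z : spaceLtilde O r, (z : VecLp O (absorptionExp r)) =ᵐ[volume.restrict O] u.val

/-- `⟨A u, v⟩ = (∇u, ∇v)`, the Stokes operator `A : 𝕍 → 𝕍'`. -/
def stokes (u v : SpaceV O) : ℝ := ∑ i, inner ℝ (u.grad i) (v.grad i)

/-- `⟨B(u), v⟩ = ∫_O ((u · ∇)u) · v dx`. -/
def convection (u v : SpaceV O) : ℝ :=
  ∫ x in O, ∑ i, (u.val x) i * inner ℝ (u.grad i x) (v.val x)

/-- `⟨C(u), v⟩ = ∫_O |u|^{r-1} u · v dx`. -/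
def absorption (r : ℝ) (u v : SpaceV O) : ℝ :=
  ∫ x in O, ‖u.val x‖ ^ (r - 1) * inner ℝ (u.val x) (v.val x)

end SpaceV

/-- `ℓ` is an eigenvalue of the Stokes operator: `A e = ℓ e` for some `e ∈ 𝕍`, `e ≠ 0`. -/
def IsStokesEigenvalue {n : ℕ} (O : Set (EuclideanSpace ℝ (Fin n))) (ℓ : ℝ) : Prop :=
  ∃ e : SpaceV O, e ≠ 0 ∧ ∀ v : SpaceV O, e.stokes v = ℓ * inner ℝ e.val v.val

/-- `λ₁`, the smallest eigenvalue of the Stokes operator. -/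
def stokesLambda1 {n : ℕ} (O : Set (EuclideanSpace ℝ (Fin n))) : ℝ :=
  sInf {ℓ | IsStokesEigenvalue O ℓ}

/-- The constant `η` for `r > 3`. In the critical case `r = 3` no such constant is needed, and
`η = 0`. -/
def cbfEta (μ β r : ℝ) : ℝ :=
  if r = 3 then 0
  else (r - 3) / (2 * μ * (r - 1)) * (2 / (β * μ * (r - 1))) ^ (2 / (r - 3))

/-- `u ∈ 𝕍 ∩ L̃^{r+1}` solves `μ A u + B(u) + β C(u) = f`, tested against
`𝕍 ∩ L̃^{r+1}`. -/
def IsStationarySolution {n : ℕ} (O : Set (EuclideanSpace ℝ (Fin n))) (μ β r : ℝ)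
    (f : StrongDual ℝ (SpaceV O)) (u : SpaceV O) : Prop :=
  u.MemLtilde r ∧ ∀ v : SpaceV O, v.MemLtilde r →
    μ * u.stokes v + u.convection v + β * u.absorption r v = f v

/-- `u` is a (global in time) weak solution of `du/dt + μ A u + B(u) + β C(u) = f`, `u(0) = u₀`:
`u ∈ C([0,∞); ℍ)`, for all `T > 0` it lies in `L²(0,T; 𝕍) ∩ L^{r+1}(0,T; L̃^{r+1})`, the
representatives being `U` and `W`, and the equation, integrated over `(0,t)`, holds against all
`v ∈ 𝕍 ∩ L̃^{r+1}`. No energy equality is imposed. -/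
def IsWeakSolution {n : ℕ} (O : Set (EuclideanSpace ℝ (Fin n))) (μ β r : ℝ)
    (f : StrongDual ℝ (SpaceV O)) (u₀ : spaceH O) (u : ℝ → spaceH O) : Prop :=
  ContinuousOn u (Set.Ici 0) ∧ u 0 = u₀ ∧
  ∃ (U : ℝ → SpaceV O) (W : ℝ → spaceLtilde O r),
    (∀ T : ℝ, 0 < T → MemLp U 2 (volume.restrict (Set.Ioc 0 T))) ∧
    (∀ T : ℝ, 0 < T → MemLp W (absorptionExp r) (volume.restrict (Set.Ioc 0 T))) ∧
    (∀ᵐ t ∂(volume.restrict (Set.Ioi (0 : ℝ))), (U t).val = u t ∧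
      (W t : VecLp O (absorptionExp r)) =ᵐ[volume.restrict O] (u t : VecLp O 2)) ∧
    ∀ v : SpaceV O, v.MemLtilde r → ∀ t : ℝ, 0 ≤ t →
      inner ℝ (u t : VecLp O 2) v.val
        + ∫ s in (0 : ℝ)..t, (μ * (U s).stokes v + (U s).convection v
            + β * (U s).absorption r v)
        = inner ℝ (u₀ : VecLp O 2) v.val + t * f v

/-- Exponential stability in `ℍ` of `u∞`: all weak solutions converge to `u∞` at the same
exponential rate. -/
def IsExponentiallyStable {n : ℕ} (O : Set (EuclideanSpace ℝ (Fin n))) (μ β r : ℝ)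
    (f : StrongDual ℝ (SpaceV O)) (uinf : SpaceV O) : Prop :=
  ∃ κ : ℝ, 0 < κ ∧ ∀ (u₀ : spaceH O) (u : ℝ → spaceH O), IsWeakSolution O μ β r f u₀ u →
    ∀ t : ℝ, 0 ≤ t →
      ‖(u t : VecLp O 2) - uinf.val‖ ≤ ‖(u₀ : VecLp O 2) - uinf.val‖ * Real.exp (-κ * t)

end

/-!
Put `w = u - u∞`. The energy inequality for `w` holds for every weak solution and needs no
approximation in space, because for almost every `t` the function `w(t)` is itself an admissible
test function. Subtract the stationary equation, test the increment of the equation over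
`(t - h, t)` with `w(t)`, and use `‖w(t)‖² - ‖w(t - h)‖² ≤ 2 (w(t) - w(t - h), w(t))`
(`IsWeakSolution.backward_difference_le`). Divide by `h`, integrate over `t ∈ (a, b)` and let
`h → 0`: the backward time averages of `∇w ∈ L²(L²)` and of the nonlinear part, which lies in
`L^{(r+1)/r}(0, T; (L^{r+1})')` since `r ≥ 3`, converge strongly
(`sub_le_integral_of_backward_difference_le`). Hence
`‖w(b)‖² - ‖w(a)‖² ≤ -2 ∫ₐᵇ (μ ‖∇w‖² + ⟨B(u) - B(u∞), w⟩ + β ⟨C(u) - C(u∞), w⟩) dt`,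
and Gronwall's lemma applies once the integrand is bounded below.

That bound is `coercive_sub`. As `b(z, w, w) = 0` for solenoidal `z`
(`convectionL_solenoidal_eq_zero`, by density of the test fields in `L̃^{r+1}` and in `𝕍`), one has
`⟨B(u) - B(u∞), w⟩ = b(w, (u + u∞)/2, w) = -b(w, w, (u + u∞)/2)`, which is at most
`∫ |∇w| |w| (|u| + |u∞|)/2`. The monotone absorption term controls
`(β/2) ∫ (|u|^{r-1} + |u∞|^{r-1}) |w|²`, and Young's inequality with exponents `(r-1)/2` and
`(r-1)/(r-3)` absorbs the convection at the price of half of the viscosity and of `η ‖w‖²`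
(`pointwise_coercive`); for `r = 3` the condition `2βμ ≥ 1` makes this possible with `η = 0`.

The remaining half of the viscosity is bounded below by `λ₁ ‖w‖²`. For this `λ₁`, defined as an
infimum of eigenvalues, is identified with the best Poincaré constant on `𝕍`
(`SpaceV.stokesLambda1_pos_and_le`): the Rayleigh quotient attains its infimum at an eigenfunction
since the unit ball of `𝕍` is precompact in `L²` (`SpaceV.totallyBounded_val_image`). The
Poincaré inequality and the compactness come from the Fourier transform: up to a tail controlled
by the gradient, the `L²` norm of a function supported in a bounded set is controlled by finitely
many of its Fourier coefficients.
-/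

noncomputable section

/-! ### Fourier bounds for compactly supported fields -/

section FourierBounds

open scoped FourierTransform SchwartzMap

variable {E H : Type*} [NormedAddCommGroup E] [InnerProductSpace ℝ E] [FiniteDimensional ℝ E]
  [MeasurableSpace E] [BorelSpace E] [NormedAddCommGroup H] [InnerProductSpace ℂ H]

lemma norm_fourierChar_sub_one_le (x : ℝ) :
    ‖(Real.fourierChar x : ℂ) - 1‖ ≤ 2 * Real.pi * |x| := by
  rw [Real.fourierChar_apply, mul_comm _ Complex.I]
  refine Real.norm_exp_I_mul_ofReal_sub_one_le.trans ?_
  rw [Real.norm_eq_abs, abs_mul, abs_of_pos Real.two_pi_pos]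

/-- The Fourier symbol of `∂ⱼ` is `2πi ⟨ξ, bⱼ⟩`. -/
lemma sum_norm_sq_fourier_lineDeriv {ι : Type*} [Fintype ι] (b : OrthonormalBasis ι ℝ E)
    (f : 𝓢(E, H)) (ξ : E) :
    ∑ j, ‖𝓕 (LineDeriv.lineDerivOp (b j) f) ξ‖ ^ 2 =
      (2 * Real.pi * ‖ξ‖) ^ 2 * ‖𝓕 f ξ‖ ^ 2 := by
  have h (j : ι) : ‖𝓕 (LineDeriv.lineDerivOp (b j) f) ξ‖ ^ 2 =
      (2 * Real.pi) ^ 2 * ‖𝓕 f ξ‖ ^ 2 * inner ℝ ξ (b j) ^ 2 := by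
    have hg : Function.HasTemperateGrowth (fun x : E ↦ inner ℝ x (b j)) := by fun_prop
    rw [SchwartzMap.fourier_lineDerivOp_eq, smul_apply,
      SchwartzMap.smulLeftCLM_apply_apply hg, norm_smul, norm_smul]
    simp only [norm_mul, Complex.norm_I, Complex.norm_real, Real.norm_eq_abs,
      abs_of_pos Real.pi_pos, mul_pow, sq_abs]
    simp
    ring
  simp_rw [h, ← Finset.mul_sum, b.sum_sq_inner_left]
  ring

/-- The low frequencies of `f` together with its gradient control `f` in `L²`: on `‖ξ‖ ≥ R` one
has `1 ≤ (‖ξ‖ / R)²`, and `2πiξ` is the symbol of the gradient. -/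
lemma integral_norm_sq_le_low_frequency [CompleteSpace H] {ι : Type*} [Fintype ι]
    (b : OrthonormalBasis ι ℝ E) (f : 𝓢(E, H)) {R : ℝ} (hR : 0 < R) :
    ∫ x, ‖f x‖ ^ 2 ≤ (∫ ξ in Metric.closedBall 0 R, ‖𝓕 f ξ‖ ^ 2) +
      ((2 * Real.pi * R) ^ 2)⁻¹ * ∑ j, ∫ x, ‖fderiv ℝ f x (b j)‖ ^ 2 := by
  have hint (g : 𝓢(E, H)) : Integrable (fun x ↦ ‖g x‖ ^ 2) :=
    (g.memLp 2 volume).integrable_norm_pow (by norm_num)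
  have hgrad : ∑ j, ∫ x, ‖fderiv ℝ f x (b j)‖ ^ 2 =
      ∫ ξ, (2 * Real.pi * ‖ξ‖) ^ 2 * ‖𝓕 f ξ‖ ^ 2 := by
    simp_rw [← sum_norm_sq_fourier_lineDeriv b f]
    rw [integral_finsetSum _ fun j _ ↦ hint _]
    refine Finset.sum_congr rfl fun j _ ↦ ?_
    rw [SchwartzMap.integral_norm_sq_fourier]
    rfl
  have hgint : Integrable (fun ξ ↦ (2 * Real.pi * ‖ξ‖) ^ 2 * ‖𝓕 f ξ‖ ^ 2) := by
    simp_rw [← sum_norm_sq_fourier_lineDeriv b f]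
    exact integrable_finsetSum _ fun j _ ↦ hint _
  rw [← SchwartzMap.integral_norm_sq_fourier f, hgrad,
    ← integral_add_compl (Metric.isClosed_closedBall (x := (0 : E)) (ε := R)).measurableSet
      (hint (𝓕 f)), ← integral_const_mul]
  gcongr
  refine (setIntegral_mono_on (hint _).integrableOn (hgint.const_mul _).integrableOn
    Metric.isClosed_closedBall.measurableSet.compl fun ξ hξ ↦ ?_).trans
    (setIntegral_le_integral (hgint.const_mul _) (ae_of_all _ fun ξ ↦ by positivity))
  have hξ' : R ≤ ‖ξ‖ := by
    simp only [Set.mem_compl_iff, Metric.mem_closedBall, dist_zero_right, not_le] at hξ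
    exact hξ.le
  rw [← mul_assoc]
  refine le_mul_of_one_le_left (by positivity) ?_
  rw [inv_mul_eq_div, one_le_div (by positivity)]
  gcongr

lemma norm_fourier_le_integral_norm (f : 𝓢(E, H)) (ξ : E) : ‖𝓕 f ξ‖ ≤ ∫ x, ‖f x‖ := by
  rw [SchwartzMap.fourier_coe, Real.fourier_eq]
  refine (norm_integral_le_integral_norm _).trans_eq ?_
  simp

/-- The Fourier transform of a function supported in a ball of radius `M` is Lipschitz, so that on
bounded sets of frequencies finitely many of its values determine it up to a small error. -/
lemma norm_fourier_sub_le (f : 𝓢(E, H)) {M : ℝ} (hf : ∀ x, f x ≠ 0 → ‖x‖ ≤ M) (ξ ζ : E) :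
    ‖𝓕 f ξ - 𝓕 f ζ‖ ≤ 2 * Real.pi * M * ‖ξ - ζ‖ * ∫ x, ‖f x‖ := by
  have hi (η : E) : Integrable (fun x ↦ Real.fourierChar (-inner ℝ x η) • f x) := by
    refine (f.integrable (μ := volume)).mono ?_ (ae_of_all _ fun x ↦ by simp)
    exact (Continuous.smul (by fun_prop) f.continuous).aestronglyMeasurable
  rw [SchwartzMap.fourier_coe, Real.fourier_eq, Real.fourier_eq, ← integral_sub (hi ξ) (hi ζ),
    ← integral_const_mul]
  refine norm_integral_le_of_norm_le ((f.integrable (μ := volume)).norm.const_mul _)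
    (ae_of_all _ fun x ↦ ?_)
  by_cases hx : f x = 0
  · simp [hx]
  have h1 : Real.fourierChar (-inner ℝ x ξ) • f x - Real.fourierChar (-inner ℝ x ζ) • f x =
      (Real.fourierChar (-inner ℝ x ζ)) •
        (((Real.fourierChar (-inner ℝ x (ξ - ζ)) : ℂ) - 1) • f x) := by
    rw [sub_smul, one_smul, smul_sub]
    congr 1
    rw [Circle.smul_def, Circle.smul_def, smul_smul, ← Circle.coe_mul, ← AddChar.map_add_eq_mul]
    congr 4
    rw [inner_sub_right]
    ring
  rw [h1, Circle.norm_smul, norm_smul]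
  refine mul_le_mul_of_nonneg_right ((norm_fourierChar_sub_one_le _).trans ?_) (norm_nonneg _)
  rw [abs_neg]
  calc 2 * Real.pi * |inner ℝ x (ξ - ζ)| ≤ 2 * Real.pi * (‖x‖ * ‖ξ - ζ‖) := by
        gcongr; exact abs_real_inner_le_norm _ _
    _ ≤ 2 * Real.pi * (M * ‖ξ - ζ‖) := by gcongr; exact hf x hx
    _ = _ := by ring

/-- Cauchy–Schwarz on a set of finite volume carrying `f`. -/
lemma sq_integral_norm_le (f : 𝓢(E, H)) {O : Set E} (hO : MeasurableSet O) (hOf : volume O ≠ ⊤)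
    (hf : ∀ x, f x ≠ 0 → x ∈ O) :
    (∫ x, ‖f x‖) ^ 2 ≤ volume.real O * ∫ x, ‖f x‖ ^ 2 := by
  have h1 : ∫ x, ‖f x‖ = ∫ x, ‖f x‖ * O.indicator (fun _ ↦ (1 : ℝ)) x := by
    congr 1 with x
    by_cases hx : x ∈ O
    · simp [hx]
    · have : f x = 0 := by by_contra h; exact hx (hf x h)
      simp [this]
  have hm : MemLp (O.indicator (fun _ ↦ (1 : ℝ))) 2 volume :=
    memLp_indicator_const 2 hO 1 (Or.inr hOf)
  have h2 := integral_mul_le_Lp_mul_Lq_of_nonneg (μ := volume) Real.HolderConjugate.two_two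
    (f := fun x ↦ ‖f x‖) (g := O.indicator (fun _ ↦ (1 : ℝ))) (ae_of_all _ fun x ↦ norm_nonneg _)
    (ae_of_all _ fun x ↦ Set.indicator_nonneg (fun _ _ ↦ zero_le_one) x)
    (by simpa using (f.memLp 2 volume).norm) (by simpa using hm)
  have h3 : ∫ x, O.indicator (fun _ ↦ (1 : ℝ)) x ^ (2 : ℝ) = volume.real O := by
    have : (fun x ↦ O.indicator (fun _ ↦ (1 : ℝ)) x ^ (2 : ℝ)) = O.indicator (fun _ ↦ (1 : ℝ)) := by
      ext x; by_cases hx : x ∈ O <;> simp [hx]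
    rw [this, integral_indicator hO]
    simp
  rw [h3, ← h1] at h2
  have h4 : 0 ≤ ∫ x, ‖f x‖ := integral_nonneg fun x ↦ norm_nonneg _
  have h5 : 0 ≤ ∫ x, ‖f x‖ ^ 2 := integral_nonneg fun x ↦ by positivity
  calc (∫ x, ‖f x‖) ^ 2 ≤ ((∫ x, ‖f x‖ ^ (2 : ℝ)) ^ (1 / (2 : ℝ)) *
        (volume.real O) ^ (1 / (2 : ℝ))) ^ 2 := by gcongr
    _ = _ := by
      rw [← Real.sqrt_eq_rpow, ← Real.sqrt_eq_rpow, mul_pow, Real.sq_sqrt measureReal_nonneg]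
      simp only [Real.rpow_ofNat]
      rw [Real.sq_sqrt h5, mul_comm]

/-- Poincaré's inequality: the part of `f̂` in a small ball is absorbed, since `|f̂|` is bounded
by `‖f‖_{L¹}`. -/
theorem exists_poincare_schwartz [CompleteSpace H] [Nontrivial E] {ι : Type*} [Fintype ι]
    (b : OrthonormalBasis ι ℝ E) {O : Set E} (hO : MeasurableSet O) (hOf : volume O ≠ ⊤) :
    ∃ C : ℝ, 0 < C ∧ ∀ f : 𝓢(E, H), (∀ x, f x ≠ 0 → x ∈ O) →
      ∫ x, ‖f x‖ ^ 2 ≤ C * ∑ j, ∫ x, ‖fderiv ℝ f x (b j)‖ ^ 2 := by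
  set c := volume.real (Metric.closedBall (0 : E) 1)
  set m := volume.real O
  have hc : 0 ≤ c := measureReal_nonneg
  have hm : 0 ≤ m := measureReal_nonneg
  set R : ℝ := min 1 (1 / (2 * (c * m + 1))) with hRdef
  have hR : 0 < R := by positivity
  have hR1 : R ≤ 1 := min_le_left _ _
  have hR2 : R ≤ 1 / (2 * (c * m + 1)) := min_le_right _ _
  have hvol : volume.real (Metric.closedBall (0 : E) R) ≤ R * c := by
    rw [Measure.real, Measure.addHaar_closedBall' _ _ hR.le, ENNReal.toReal_mul,
      ENNReal.toReal_ofReal (by positivity)]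
    gcongr
    · exact pow_le_of_le_one hR.le hR1 Module.finrank_pos.ne'
    · exact le_rfl
  refine ⟨2 * ((2 * Real.pi * R) ^ 2)⁻¹, by positivity, fun f hf ↦ ?_⟩
  have h1 := integral_norm_sq_le_low_frequency b f hR
  have h2 := sq_integral_norm_le f hO hOf hf
  have h3 : ∫ ξ in Metric.closedBall 0 R, ‖𝓕 f ξ‖ ^ 2 ≤
      volume.real (Metric.closedBall (0 : E) R) * (m * ∫ x, ‖f x‖ ^ 2) := by
    calc ∫ ξ in Metric.closedBall 0 R, ‖𝓕 f ξ‖ ^ 2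
        ≤ ∫ ξ in Metric.closedBall (0 : E) R, m * ∫ x, ‖f x‖ ^ 2 := by
          refine setIntegral_mono_on ?_ ?_ Metric.isClosed_closedBall.measurableSet fun ξ _ ↦ ?_
          · exact ((𝓕 f).memLp 2 volume).integrable_norm_pow (by norm_num) |>.integrableOn
          · exact integrableOn_const measure_closedBall_lt_top.ne
          · refine le_trans ?_ h2
            gcongr
            exact norm_fourier_le_integral_norm f ξ
      _ = _ := by
        rw [setIntegral_const, smul_eq_mul]
  have h5 : 0 ≤ ∫ x, ‖f x‖ ^ 2 := integral_nonneg fun x ↦ by positivity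
  have h4 : volume.real (Metric.closedBall (0 : E) R) * (m * ∫ x, ‖f x‖ ^ 2) ≤
      1 / 2 * ∫ x, ‖f x‖ ^ 2 := by
    rw [← mul_assoc]
    gcongr
    calc volume.real (Metric.closedBall (0 : E) R) * m ≤ R * c * m := by gcongr
      _ ≤ 1 / (2 * (c * m + 1)) * c * m := by gcongr
      _ ≤ 1 / 2 := by
        have : 0 < c * m + 1 := by positivity
        field_simp
        linarith
  linarith

/-- Finitely many values of `f̂`, together with a small multiple of the `H¹`-norm, control `f` in
`L²`: on a large ball `f̂` is uniformly Lipschitz, hence close to its values on a fine net. -/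
theorem exists_finset_fourier_bound [CompleteSpace H] {ι : Type*} [Fintype ι]
    (b : OrthonormalBasis ι ℝ E) {O : Set E} (hO : MeasurableSet O) (hOb : Bornology.IsBounded O)
    {ε : ℝ} (hε : 0 < ε) :
    ∃ (S : Finset E) (C : ℝ), 0 ≤ C ∧ ∀ f : 𝓢(E, H), (∀ x, f x ≠ 0 → x ∈ O) →
      ∫ x, ‖f x‖ ^ 2 ≤ C * ∑ ζ ∈ S, ‖𝓕 f ζ‖ ^ 2 +
        ε * ((∫ x, ‖f x‖ ^ 2) + ∑ j, ∫ x, ‖fderiv ℝ f x (b j)‖ ^ 2) := by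
  obtain ⟨M, hMpos, hM⟩ := hOb.exists_pos_norm_le
  have hOf : volume O ≠ ⊤ := hOb.measure_lt_top.ne
  set m := volume.real O
  have hm : 0 ≤ m := measureReal_nonneg
  obtain ⟨R, hR, hRε⟩ : ∃ R : ℝ, 0 < R ∧ ((2 * Real.pi * R) ^ 2)⁻¹ ≤ ε := by
    refine ⟨(Real.sqrt ε)⁻¹, by positivity, ?_⟩
    rw [mul_pow, mul_inv, inv_pow, inv_inv, Real.sq_sqrt hε.le]
    refine mul_le_of_le_one_left hε.le (inv_le_one_of_one_le₀ (one_le_pow₀ ?_))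
    linarith [Real.pi_gt_three]
  set c := volume.real (Metric.closedBall (0 : E) R)
  have hc : 0 ≤ c := measureReal_nonneg
  set K := 2 * c * ((2 * Real.pi * M) ^ 2 * m)
  have hK : 0 ≤ K := by positivity
  obtain ⟨δ, hδ, hδε⟩ : ∃ δ : ℝ, 0 < δ ∧ K * δ ^ 2 ≤ ε := by
    refine ⟨Real.sqrt (ε / (K + 1)), by positivity, ?_⟩
    rw [Real.sq_sqrt (by positivity), mul_div_assoc', div_le_iff₀ (by positivity)]
    nlinarith
  obtain ⟨t, -, htf, ht⟩ := (isCompact_closedBall (0 : E) R).finite_cover_balls hδ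
  refine ⟨htf.toFinset, 2 * c, by positivity, fun f hf ↦ ?_⟩
  set S := htf.toFinset
  have h1 := integral_norm_sq_le_low_frequency b f hR
  have h2 := sq_integral_norm_le f hO hOf hf
  have h5 : 0 ≤ ∫ x, ‖f x‖ ^ 2 := integral_nonneg fun x ↦ by positivity
  have h6 : 0 ≤ ∑ j, ∫ x, ‖fderiv ℝ f x (b j)‖ ^ 2 :=
    Finset.sum_nonneg fun j _ ↦ integral_nonneg fun x ↦ by positivity
  have hpt : ∀ ξ ∈ Metric.closedBall (0 : E) R, ‖𝓕 f ξ‖ ^ 2 ≤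
      2 * ∑ ζ ∈ S, ‖𝓕 f ζ‖ ^ 2 + 2 * ((2 * Real.pi * M * δ) ^ 2 * (m * ∫ x, ‖f x‖ ^ 2)) := by
    intro ξ hξ
    obtain ⟨ζ, hζ, hξζ⟩ := Set.mem_iUnion₂.1 (ht hξ)
    rw [Metric.mem_ball, dist_eq_norm] at hξζ
    have ha : ‖𝓕 f ζ‖ ^ 2 ≤ ∑ ζ ∈ S, ‖𝓕 f ζ‖ ^ 2 :=
      Finset.single_le_sum (f := fun ζ ↦ ‖𝓕 f ζ‖ ^ 2) (fun _ _ ↦ by positivity)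
        (htf.mem_toFinset.2 hζ)
    have hb : ‖𝓕 f ξ - 𝓕 f ζ‖ ^ 2 ≤ (2 * Real.pi * M * δ) ^ 2 * (m * ∫ x, ‖f x‖ ^ 2) := by
      calc ‖𝓕 f ξ - 𝓕 f ζ‖ ^ 2 ≤ (2 * Real.pi * M * ‖ξ - ζ‖ * ∫ x, ‖f x‖) ^ 2 := by
            gcongr
            exact norm_fourier_sub_le f (fun x hx ↦ hM x (hf x hx)) ξ ζ
        _ ≤ (2 * Real.pi * M * δ * ∫ x, ‖f x‖) ^ 2 := by
            have : 0 ≤ ∫ x, ‖f x‖ := integral_nonneg fun x ↦ norm_nonneg _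
            gcongr
        _ ≤ _ := by rw [mul_pow]; gcongr
    have hc : ‖𝓕 f ξ‖ ^ 2 ≤ 2 * ‖𝓕 f ζ‖ ^ 2 + 2 * ‖𝓕 f ξ - 𝓕 f ζ‖ ^ 2 := by
      have : ‖𝓕 f ξ‖ ≤ ‖𝓕 f ζ‖ + ‖𝓕 f ξ - 𝓕 f ζ‖ := by
        simpa using norm_add_le (𝓕 f ζ) (𝓕 f ξ - 𝓕 f ζ)
      nlinarith [norm_nonneg (𝓕 f ξ), sq_nonneg (‖𝓕 f ζ‖ - ‖𝓕 f ξ - 𝓕 f ζ‖)]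
    linarith
  have h3 : ∫ ξ in Metric.closedBall 0 R, ‖𝓕 f ξ‖ ^ 2 ≤
      c * (2 * ∑ ζ ∈ S, ‖𝓕 f ζ‖ ^ 2 + 2 * ((2 * Real.pi * M * δ) ^ 2 * (m * ∫ x, ‖f x‖ ^ 2))) := by
    rw [← smul_eq_mul, ← setIntegral_const]
    refine setIntegral_mono_on ?_ ?_ Metric.isClosed_closedBall.measurableSet hpt
    · exact ((𝓕 f).memLp 2 volume).integrable_norm_pow (by norm_num) |>.integrableOn
    · exact integrableOn_const (measure_closedBall_lt_top).ne
  have h7 : K * δ ^ 2 * ∫ x, ‖f x‖ ^ 2 ≤ ε * ∫ x, ‖f x‖ ^ 2 := by gcongr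
  have h8 : ((2 * Real.pi * R) ^ 2)⁻¹ * ∑ j, ∫ x, ‖fderiv ℝ f x (b j)‖ ^ 2 ≤
      ε * ∑ j, ∫ x, ‖fderiv ℝ f x (b j)‖ ^ 2 := by gcongr
  calc ∫ x, ‖f x‖ ^ 2 ≤ _ := h1
    _ ≤ c * (2 * ∑ ζ ∈ S, ‖𝓕 f ζ‖ ^ 2 + 2 * ((2 * Real.pi * M * δ) ^ 2 * (m * ∫ x, ‖f x‖ ^ 2))) +
        ε * ∑ j, ∫ x, ‖fderiv ℝ f x (b j)‖ ^ 2 := add_le_add h3 h8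
    _ = 2 * c * ∑ ζ ∈ S, ‖𝓕 f ζ‖ ^ 2 + (K * δ ^ 2 * (∫ x, ‖f x‖ ^ 2) +
        ε * ∑ j, ∫ x, ‖fderiv ℝ f x (b j)‖ ^ 2) := by ring
    _ ≤ _ := by linarith

end FourierBounds

/-! ### Test fields and the spaces they generate -/

section TestFields

variable {n : ℕ} {O : Set (EuclideanSpace ℝ (Fin n))}
  {φ ψ : EuclideanSpace ℝ (Fin n) → EuclideanSpace ℝ (Fin n)}

namespace IsTestField

lemma differentiable (h : IsTestField O φ) : Differentiable ℝ φ :=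
  h.smooth.differentiable (by simp)

lemma zero : IsTestField O (0 : EuclideanSpace ℝ (Fin n) → EuclideanSpace ℝ (Fin n)) where
  smooth := contDiff_const
  compactSupport := HasCompactSupport.zero
  support_subset := by simp [tsupport]
  div_eq_zero x := by simp

lemma add (hφ : IsTestField O φ) (hψ : IsTestField O ψ) : IsTestField O (φ + ψ) where
  smooth := hφ.smooth.add hψ.smooth
  compactSupport := hφ.compactSupport.add hψ.compactSupport
  support_subset := (tsupport_add φ ψ).trans (Set.union_subset hφ.support_subset hψ.support_subset)
  div_eq_zero x := by
    rw [fderiv_add (hφ.differentiable x) (hψ.differentiable x)]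
    simp [Finset.sum_add_distrib, hφ.div_eq_zero x, hψ.div_eq_zero x]

lemma const_smul (hφ : IsTestField O φ) (c : ℝ) : IsTestField O (c • φ) where
  smooth := hφ.smooth.const_smul c
  compactSupport := hφ.compactSupport.smul_left (f := fun _ ↦ c)
  support_subset := (tsupport_smul_subset_right (fun _ ↦ c) φ).trans hφ.support_subset
  div_eq_zero x := by
    rw [fderiv_const_smul (hφ.differentiable x)]
    simp [← Finset.mul_sum, hφ.div_eq_zero x]

lemma eq_zero_of_notMem (hφ : IsTestField O φ) {x : EuclideanSpace ℝ (Fin n)} (hx : x ∉ O) :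
    φ x = 0 :=
  image_eq_zero_of_notMem_tsupport fun h ↦ hx (hφ.support_subset h)

lemma fderiv_eq_zero_of_notMem (hφ : IsTestField O φ) {x : EuclideanSpace ℝ (Fin n)}
    (hx : x ∉ O) : fderiv ℝ φ x = 0 :=
  image_eq_zero_of_notMem_tsupport fun h ↦ hx (hφ.support_subset (tsupport_fderiv_subset ℝ h))

lemma continuous_fderiv_apply (hφ : IsTestField O φ) (v : EuclideanSpace ℝ (Fin n)) :
    Continuous fun x ↦ fderiv ℝ φ x v :=
  (hφ.smooth.continuous_fderiv (by simp)).clm_apply continuous_const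

lemma hasCompactSupport_fderiv_apply (hφ : IsTestField O φ) (v : EuclideanSpace ℝ (Fin n)) :
    HasCompactSupport fun x ↦ fderiv ℝ φ x v :=
  hφ.compactSupport.fderiv_apply ℝ v

lemma memLp (hφ : IsTestField O φ) (p : ℝ≥0∞) : MemLp φ p (volume.restrict O) :=
  (hφ.smooth.continuous.memLp_of_hasCompactSupport hφ.compactSupport).mono_measure
    Measure.restrict_le_self

lemma memLp_fderiv (hφ : IsTestField O φ) (v : EuclideanSpace ℝ (Fin n)) (p : ℝ≥0∞) :
    MemLp (fun x ↦ fderiv ℝ φ x v) p (volume.restrict O) :=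
  ((hφ.continuous_fderiv_apply v).memLp_of_hasCompactSupport
    (hφ.hasCompactSupport_fderiv_apply v)).mono_measure Measure.restrict_le_self

end IsTestField

/-- The classes in `L^p(O; ℝⁿ)` of the divergence-free test fields. -/
def testLp (O : Set (EuclideanSpace ℝ (Fin n))) (p : ℝ≥0∞) : Submodule ℝ (VecLp O p) where
  carrier := {x | ∃ φ, IsTestField O φ ∧ x =ᵐ[volume.restrict O] φ}
  add_mem' := by
    rintro x y ⟨φ, hφ, hx⟩ ⟨ψ, hψ, hy⟩
    exact ⟨φ + ψ, hφ.add hψ, (Lp.coeFn_add x y).trans (hx.add hy)⟩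
  zero_mem' := ⟨0, IsTestField.zero, Lp.coeFn_zero _ _ _⟩
  smul_mem' := by
    rintro c x ⟨φ, hφ, hx⟩
    exact ⟨c • φ, hφ.const_smul c, (Lp.coeFn_smul c x).trans (hx.const_smul c)⟩

/-- The pairs `(φ, ∇φ)` of divergence-free test fields and their gradients. -/
def testPairs (O : Set (EuclideanSpace ℝ (Fin n))) : Submodule ℝ (SobolevPair O) where
  carrier := {x | ∃ φ, IsTestField O φ ∧ x.fst =ᵐ[volume.restrict O] φ ∧
    ∀ i, x.snd i =ᵐ[volume.restrict O] fun y => fderiv ℝ φ y (EuclideanSpace.single i 1)}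
  add_mem' := by
    rintro x y ⟨φ, hφ, hx, hx'⟩ ⟨ψ, hψ, hy, hy'⟩
    refine ⟨φ + ψ, hφ.add hψ, (Lp.coeFn_add _ _).trans (hx.add hy), fun i ↦ ?_⟩
    refine (Lp.coeFn_add _ _).trans (((hx' i).add (hy' i)).trans (ae_of_all _ fun y ↦ ?_))
    simp [fderiv_add (hφ.differentiable y) (hψ.differentiable y)]
  zero_mem' := by
    refine ⟨0, IsTestField.zero, Lp.coeFn_zero _ _ _, fun i ↦ (Lp.coeFn_zero _ _ _).trans ?_⟩
    exact ae_of_all _ fun y ↦ by simp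
  smul_mem' := by
    rintro c x ⟨φ, hφ, hx, hx'⟩
    refine ⟨c • φ, hφ.const_smul c, (Lp.coeFn_smul _ _).trans (hx.const_smul c), fun i ↦ ?_⟩
    refine (Lp.coeFn_smul _ _).trans (((hx' i).const_smul c).trans (ae_of_all _ fun y ↦ ?_))
    simp [fderiv_const_smul (hφ.differentiable y)]

lemma solenoidalLp_eq_closure (O : Set (EuclideanSpace ℝ (Fin n))) (p : ℝ≥0∞) [Fact (1 ≤ p)] :
    (solenoidalLp O p : Set (VecLp O p)) = closure (testLp O p) := by
  have h : Submodule.span ℝ (testLp O p : Set (VecLp O p)) = testLp O p := Submodule.span_eq _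
  rw [← h]
  rfl

lemma sobolevV_eq_closure (O : Set (EuclideanSpace ℝ (Fin n))) :
    (sobolevV O : Set (SobolevPair O)) = closure (testPairs O) := by
  have h : Submodule.span ℝ (testPairs O : Set (SobolevPair O)) = testPairs O :=
    Submodule.span_eq _
  rw [← h]
  rfl

/-- A closed property of `(u, ∇u)` holds on `𝕍` once it holds for test fields. -/
lemma SpaceV.mem_of_isClosed {s : Set (SobolevPair O)} (hs : IsClosed s)
    (htest : ∀ x ∈ testPairs O, x ∈ s) (u : SpaceV O) : (u : SobolevPair O) ∈ s := by
  have hu : (u : SobolevPair O) ∈ (sobolevV O : Set (SobolevPair O)) := u.2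
  rw [sobolevV_eq_closure] at hu
  exact closure_minimal htest hs hu

/-- The pair `(φ, ∇φ)` of a test field, as an element of `𝕍`. -/
def IsTestField.toSpaceV (hφ : IsTestField O φ) : SpaceV O :=
  ⟨WithLp.toLp 2 ((hφ.memLp 2).toLp φ, WithLp.toLp 2 fun i ↦ (hφ.memLp_fderiv _ 2).toLp _), by
    rw [← SetLike.mem_coe, sobolevV_eq_closure]
    exact subset_closure ⟨φ, hφ, (hφ.memLp 2).coeFn_toLp, fun i ↦ (hφ.memLp_fderiv _ 2).coeFn_toLp⟩⟩

instance : CompleteSpace (SpaceV O) := by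
  have : IsClosed (sobolevV O : Set (SobolevPair O)) := by
    rw [sobolevV_eq_closure]; exact isClosed_closure
  exact this.completeSpace_coe

namespace SpaceV

/-- `u ↦ u`, from `𝕍` to `L²`, as a continuous linear map. -/
def valL : SpaceV O →L[ℝ] VecLp O 2 :=
  (WithLp.fstL 2 ℝ (VecLp O 2) (PiLp 2 fun _ : Fin n => VecLp O 2)).comp (sobolevV O).subtypeL

/-- `u ↦ ∇u` as a continuous linear map on `𝕍`. -/
def gradL : SpaceV O →L[ℝ] PiLp 2 (fun _ : Fin n => VecLp O 2) :=
  (WithLp.sndL 2 ℝ (VecLp O 2) (PiLp 2 fun _ : Fin n => VecLp O 2)).comp (sobolevV O).subtypeL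

@[simp] lemma valL_apply (u : SpaceV O) : valL u = u.val := rfl

lemma gradL_apply (u : SpaceV O) (i : Fin n) : gradL u i = u.grad i := rfl

lemma stokes_eq_inner (u v : SpaceV O) : u.stokes v = inner ℝ (gradL u) (gradL v) := by
  simp [stokes, PiLp.inner_apply, gradL_apply]

lemma norm_sq_eq (u : SpaceV O) : ‖u‖ ^ 2 = ‖u.val‖ ^ 2 + ‖gradL u‖ ^ 2 :=
  WithLp.prod_norm_sq_eq_of_L2 _

end SpaceV

end TestFields

/-! ### Compactness of the embedding of `𝕍` in `L²` -/

section Compactness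

open scoped FourierTransform SchwartzMap

variable {n : ℕ} {O : Set (EuclideanSpace ℝ (Fin n))}
  {φ : EuclideanSpace ℝ (Fin n) → EuclideanSpace ℝ (Fin n)}

lemma VecLp.norm_sq_eq_integral (v : VecLp O 2) : ‖v‖ ^ 2 = ∫ x in O, ‖v x‖ ^ 2 := by
  rw [← real_inner_self_eq_norm_sq, L2.inner_def]
  simp

/-- The isometric embedding `ℝⁿ → ℂⁿ`. -/
def complexify (n : ℕ) : EuclideanSpace ℝ (Fin n) →L[ℝ] EuclideanSpace ℂ (Fin n) :=
  LinearMap.toContinuousLinearMap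
    { toFun := fun x ↦ WithLp.toLp 2 fun i ↦ (x i : ℂ)
      map_add' := fun x y ↦ by ext i; simp
      map_smul' := fun c x ↦ by ext i; simp }

lemma norm_complexify (x : EuclideanSpace ℝ (Fin n)) : ‖complexify n x‖ = ‖x‖ := by
  simp [complexify, EuclideanSpace.norm_eq]

namespace IsTestField

/-- A test field as a complex Schwartz function. -/
def toSchwartz (hφ : IsTestField O φ) :
    𝓢(EuclideanSpace ℝ (Fin n), EuclideanSpace ℂ (Fin n)) :=
  (hφ.compactSupport.comp_left (map_zero (complexify n))).toSchwartzMap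
    ((complexify n).contDiff.comp hφ.smooth)

lemma toSchwartz_apply (hφ : IsTestField O φ) (x : EuclideanSpace ℝ (Fin n)) :
    hφ.toSchwartz x = complexify n (φ x) := rfl

lemma norm_toSchwartz (hφ : IsTestField O φ) (x : EuclideanSpace ℝ (Fin n)) :
    ‖hφ.toSchwartz x‖ = ‖φ x‖ := norm_complexify _

lemma norm_fderiv_toSchwartz (hφ : IsTestField O φ) (x v : EuclideanSpace ℝ (Fin n)) :
    ‖fderiv ℝ hφ.toSchwartz x v‖ = ‖fderiv ℝ φ x v‖ := by
  have h : (hφ.toSchwartz : EuclideanSpace ℝ (Fin n) → EuclideanSpace ℂ (Fin n)) =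
    complexify n ∘ φ := rfl
  rw [h, fderiv_comp x (complexify n).differentiableAt (hφ.differentiable x)]
  simp [norm_complexify]

lemma mem_of_toSchwartz_ne_zero (hφ : IsTestField O φ) (x : EuclideanSpace ℝ (Fin n))
    (hx : hφ.toSchwartz x ≠ 0) : x ∈ O := by
  by_contra h
  exact hx (by rw [toSchwartz_apply, hφ.eq_zero_of_notMem h, map_zero])

lemma norm_sq_eq_integral_toSchwartz (hφ : IsTestField O φ) {v : VecLp O 2}
    (hv : v =ᵐ[volume.restrict O] φ) : ‖v‖ ^ 2 = ∫ x, ‖hφ.toSchwartz x‖ ^ 2 := by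
  rw [VecLp.norm_sq_eq_integral]
  refine Eq.trans ?_ (setIntegral_eq_integral_of_forall_compl_eq_zero (s := O) ?_)
  · refine integral_congr_ae ?_
    filter_upwards [hv] with x hx
    rw [hx, norm_toSchwartz]
  · intro x hx
    simp [norm_toSchwartz, hφ.eq_zero_of_notMem hx]

lemma norm_sq_eq_integral_fderiv_toSchwartz (hφ : IsTestField O φ)
    (w : EuclideanSpace ℝ (Fin n)) {v : VecLp O 2}
    (hv : v =ᵐ[volume.restrict O] fun y ↦ fderiv ℝ φ y w) :
    ‖v‖ ^ 2 = ∫ x, ‖fderiv ℝ hφ.toSchwartz x w‖ ^ 2 := by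
  rw [VecLp.norm_sq_eq_integral]
  refine Eq.trans ?_ (setIntegral_eq_integral_of_forall_compl_eq_zero (s := O) ?_)
  · refine integral_congr_ae ?_
    filter_upwards [hv] with x hx
    rw [hx, norm_fderiv_toSchwartz]
  · intro x hx
    simp [norm_fderiv_toSchwartz, hφ.fderiv_eq_zero_of_notMem hx]

end IsTestField

namespace SpaceV

/-- Poincaré's inequality on `𝕍`. -/
theorem exists_poincare (hn : n ≠ 0) (hO : IsOpen O) (hOb : Bornology.IsBounded O) :
    ∃ C : ℝ, 0 < C ∧ ∀ u : SpaceV O, ‖u.val‖ ^ 2 ≤ C * ‖gradL u‖ ^ 2 := by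
  have : Nonempty (Fin n) := ⟨⟨0, Nat.pos_of_ne_zero hn⟩⟩
  obtain ⟨C, hC, h⟩ := exists_poincare_schwartz (H := EuclideanSpace ℂ (Fin n))
    (EuclideanSpace.basisFun (Fin n) ℝ) hO.measurableSet hOb.measure_lt_top.ne
  refine ⟨C, hC, fun u ↦ ?_⟩
  refine mem_of_isClosed
    (s := {x : SobolevPair O | ‖x.fst‖ ^ 2 ≤ C * ‖x.snd‖ ^ 2})
    (isClosed_le (by fun_prop) (by fun_prop)) ?_ u
  rintro x ⟨φ, hφ, hx, hx'⟩
  have := h hφ.toSchwartz hφ.mem_of_toSchwartz_ne_zero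
  rw [Set.mem_ofPred_eq, PiLp.norm_sq_eq_of_L2, hφ.norm_sq_eq_integral_toSchwartz hx]
  simp_rw [fun i ↦ hφ.norm_sq_eq_integral_fderiv_toSchwartz _ (hx' i)]
  simpa using this

lemma memLp_fourierChar (hOb : Bornology.IsBounded O) (ζ : EuclideanSpace ℝ (Fin n)) :
    MemLp (fun x ↦ (Real.fourierChar (-inner ℝ x ζ) : ℂ)) 2 (volume.restrict O) :=
  have : IsFiniteMeasure (volume.restrict O) := ⟨by simpa using hOb.measure_lt_top⟩
  MemLp.of_bound (Continuous.aestronglyMeasurable (by fun_prop)) 1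
    (ae_of_all _ fun x ↦ (Circle.norm_coe _).le)

/-- The Fourier coefficient `∫_O e^{-2πi x·ζ} v(x) dx`, as a functional on `L²`. -/
def fourierCoeffL (hOb : Bornology.IsBounded O) (ζ : EuclideanSpace ℝ (Fin n)) :
    VecLp O 2 →L[ℝ] EuclideanSpace ℂ (Fin n) :=
  ((ContinuousLinearMap.lsmul ℝ ℂ).bilinearComp (.id ℝ ℂ) (complexify n)).lpPairing
    (volume.restrict O) 2 2 (memLp_fourierChar hOb ζ).toLp

lemma fourierCoeffL_apply (hOb : Bornology.IsBounded O) (hφ : IsTestField O φ) {v : VecLp O 2}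
    (hv : v =ᵐ[volume.restrict O] φ) (ζ : EuclideanSpace ℝ (Fin n)) :
    fourierCoeffL hOb ζ v = 𝓕 hφ.toSchwartz ζ := by
  rw [fourierCoeffL, ContinuousLinearMap.lpPairing_eq_integral, SchwartzMap.fourier_coe,
    Real.fourier_eq]
  refine Eq.trans ?_ (setIntegral_eq_integral_of_forall_compl_eq_zero (s := O) ?_)
  · refine integral_congr_ae ?_
    filter_upwards [hv, MemLp.coeFn_toLp (memLp_fourierChar hOb ζ)] with x hx hx'
    rw [hx', hx]
    rfl
  · intro x hx
    rw [hφ.toSchwartz_apply, hφ.eq_zero_of_notMem hx, map_zero, smul_zero]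

/-- Up to a small multiple of the `𝕍`-norm, the `L²`-norm on `𝕍` is controlled by finitely many
bounded functionals on `L²`. -/
theorem exists_finset_fourierCoeffL_bound (hO : IsOpen O) (hOb : Bornology.IsBounded O) {ε : ℝ}
    (hε : 0 < ε) : ∃ (S : Finset (EuclideanSpace ℝ (Fin n))) (C : ℝ), 0 ≤ C ∧ ∀ u : SpaceV O,
      ‖u.val‖ ^ 2 ≤ C * ∑ ζ ∈ S, ‖fourierCoeffL hOb ζ u.val‖ ^ 2 + ε * ‖u‖ ^ 2 := by
  obtain ⟨S, C, hC, h⟩ := exists_finset_fourier_bound (H := EuclideanSpace ℂ (Fin n))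
    (EuclideanSpace.basisFun (Fin n) ℝ) hO.measurableSet hOb hε
  refine ⟨S, C, hC, fun u ↦ ?_⟩
  refine mem_of_isClosed (s := {x : SobolevPair O | ‖x.fst‖ ^ 2 ≤
    C * ∑ ζ ∈ S, ‖fourierCoeffL hOb ζ x.fst‖ ^ 2 + ε * ‖x‖ ^ 2})
    (isClosed_le (by fun_prop) (by fun_prop)) ?_ u
  rintro x ⟨φ, hφ, hx, hx'⟩
  have := h hφ.toSchwartz hφ.mem_of_toSchwartz_ne_zero
  rw [Set.mem_ofPred_eq, WithLp.prod_norm_sq_eq_of_L2, PiLp.norm_sq_eq_of_L2,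
    hφ.norm_sq_eq_integral_toSchwartz hx]
  simp_rw [fun i ↦ hφ.norm_sq_eq_integral_fderiv_toSchwartz _ (hx' i),
    fourierCoeffL_apply hOb hφ hx]
  simpa using this

/-- Rellich's theorem: bounded sets of `𝕍` are totally bounded in `L²`. -/
theorem totallyBounded_val_image (hO : IsOpen O) (hOb : Bornology.IsBounded O) (M : ℝ) :
    TotallyBounded (val '' {u : SpaceV O | ‖u‖ ≤ M}) := by
  set A := {u : SpaceV O | ‖u‖ ≤ M}
  rw [Metric.totallyBounded_iff]
  intro ε hε
  obtain ⟨S, C, hC, h⟩ := exists_finset_fourierCoeffL_bound hO hOb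
    (ε := ε ^ 2 / (8 * (M ^ 2 + 1))) (by positivity)
  set L : VecLp O 2 →L[ℝ] S → EuclideanSpace ℂ (Fin n) :=
    ContinuousLinearMap.pi fun ζ ↦ fourierCoeffL hOb ζ
  have hL : TotallyBounded ((fun u : SpaceV O ↦ L u.val) '' A) := by
    have hb : Bornology.IsBounded A :=
      (Metric.isBounded_closedBall (x := (0 : SpaceV O)) (r := M)).subset fun u hu ↦
        mem_closedBall_zero_iff.2 hu
    exact ((L.comp valL).lipschitz.isBounded_image hb).isCompact_closure.totallyBounded.subset
      subset_closure
  set δ : ℝ := ε / (2 * Real.sqrt (C * S.card + 1))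
  have hδ : 0 < δ := by positivity
  have hδ2 : C * S.card * δ ^ 2 ≤ ε ^ 2 / 4 := by
    rw [div_pow, mul_pow, Real.sq_sqrt (by positivity), mul_div_assoc', div_le_iff₀ (by positivity)]
    nlinarith [sq_nonneg ε]
  obtain ⟨s, hsA, hsf, ht⟩ := Set.exists_subset_image_finite_and.1
    (Metric.finite_approx_of_totallyBounded hL δ hδ)
  refine ⟨val '' s, hsf.image _, ?_⟩
  rintro - ⟨u, hu, rfl⟩
  obtain ⟨-, ⟨v, hv, rfl⟩, huv⟩ := Set.mem_iUnion₂.1 (ht ⟨u, hu, rfl⟩)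
  refine Set.mem_iUnion₂.2 ⟨v.val, ⟨v, hv, rfl⟩, ?_⟩
  have h1 := h (u - v)
  have h2 : ‖u - v‖ ^ 2 ≤ 4 * M ^ 2 := by
    have : ‖u - v‖ ≤ 2 * M := (norm_sub_le u v).trans (by
      have h1 : ‖u‖ ≤ M := hu
      have h2 : ‖v‖ ≤ M := hsA hv
      linarith)
    nlinarith [norm_nonneg (u - v)]
  have h3 : ∑ ζ ∈ S, ‖fourierCoeffL hOb ζ (u - v).val‖ ^ 2 ≤ S.card * δ ^ 2 := by
    rw [← nsmul_eq_mul]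
    refine Finset.sum_le_card_nsmul _ _ _ fun ζ hζ ↦ ?_
    have h4 : ‖L u.val - L v.val‖ < δ := by simpa [dist_eq_norm] using huv
    have h5 := (norm_le_pi_norm (L u.val - L v.val) ⟨ζ, hζ⟩).trans h4.le
    have h6 : fourierCoeffL hOb ζ (u - v).val = (L u.val - L v.val) ⟨ζ, hζ⟩ := by
      rw [← map_sub]; rfl
    rw [h6]
    gcongr
  rw [Metric.mem_ball, dist_eq_norm]
  refine lt_of_pow_lt_pow_left₀ 2 hε.le ?_
  calc ‖u.val - v.val‖ ^ 2 ≤ C * (S.card * δ ^ 2) +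
        ε ^ 2 / (8 * (M ^ 2 + 1)) * (4 * M ^ 2) := by
        refine h1.trans ?_
        gcongr
    _ ≤ ε ^ 2 / 4 + ε ^ 2 / 2 := by
        rw [← mul_assoc]
        refine add_le_add hδ2 ?_
        rw [div_mul_eq_mul_div, div_le_div_iff₀ (by positivity) (by positivity)]
        nlinarith [sq_nonneg ε]
    _ < ε ^ 2 := by nlinarith [sq_pos_of_pos hε]

end SpaceV

end Compactness

/-! ### The first Stokes eigenvalue -/

section FirstEigenvalue

variable {n : ℕ} {O : Set (EuclideanSpace ℝ (Fin n))}

/-- A nonzero divergence-free test field: the rotated gradient `(∂₁ψ, -∂₀ψ, 0, …)` of a bump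
function `ψ`. -/
lemma exists_isTestField_ne_zero (hn : 2 ≤ n) (hO : IsOpen O) (hne : O.Nonempty) :
    ∃ φ, IsTestField O φ ∧ φ ≠ 0 := by
  obtain ⟨x₀, hx₀⟩ := hne
  obtain ⟨ρ, hρ, hρO⟩ := Metric.nhds_basis_closedBall.mem_iff.1 (hO.mem_nhds hx₀)
  let i₀ : Fin n := ⟨0, by omega⟩
  let i₁ : Fin n := ⟨1, by omega⟩
  have hi : i₀ ≠ i₁ := by simp [i₀, i₁]
  let e₀ : EuclideanSpace ℝ (Fin n) := EuclideanSpace.single i₀ 1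
  let e₁ : EuclideanSpace ℝ (Fin n) := EuclideanSpace.single i₁ 1
  let ψ : ContDiffBump x₀ := ⟨ρ / 2, ρ, by positivity, by linarith⟩
  have hψ : ContDiff ℝ ∞ (ψ : EuclideanSpace ℝ (Fin n) → ℝ) := ψ.contDiff
  have hdψ : ContDiff ℝ ∞ (fderiv ℝ (ψ : EuclideanSpace ℝ (Fin n) → ℝ)) :=
    hψ.fderiv_right (by simp)
  have hdd (x : EuclideanSpace ℝ (Fin n)) :
      DifferentiableAt ℝ (fderiv ℝ (ψ : EuclideanSpace ℝ (Fin n) → ℝ)) x :=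
    (hdψ.differentiable (by simp)) x
  have hdir (v : EuclideanSpace ℝ (Fin n)) (x : EuclideanSpace ℝ (Fin n)) :
      HasFDerivAt (fun y ↦ fderiv ℝ ψ y v)
        ((fderiv ℝ (fderiv ℝ (ψ : EuclideanSpace ℝ (Fin n) → ℝ)) x).flip v) x := by
    simpa using (hdd x).hasFDerivAt.clm_apply (hasFDerivAt_const v x)
  refine ⟨fun x ↦ fderiv ℝ ψ x e₁ • e₀ - fderiv ℝ ψ x e₀ • e₁, ⟨?_, ?_, ?_, ?_⟩, ?_⟩
  · exact ((hdψ.clm_apply contDiff_const).smul contDiff_const).sub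
      ((hdψ.clm_apply contDiff_const).smul contDiff_const)
  · exact ((ψ.hasCompactSupport.fderiv_apply ℝ e₁).smul_right).sub
      ((ψ.hasCompactSupport.fderiv_apply ℝ e₀).smul_right)
  · refine subset_trans ?_ (ψ.tsupport_eq.trans_subset hρO)
    refine closure_minimal (fun x hx ↦ ?_) (isClosed_tsupport _)
    by_contra h
    refine hx ?_
    simp [image_eq_zero_of_notMem_tsupport
      (fun h' ↦ h (tsupport_fderiv_subset ℝ h') : x ∉ tsupport (fderiv ℝ ψ))]
  · intro x
    have hsymm : IsSymmSndFDerivAt ℝ (ψ : EuclideanSpace ℝ (Fin n) → ℝ) x :=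
      hψ.contDiffAt.isSymmSndFDerivAt (by
        simpa using ENat.LEInfty.out)
    have h : HasFDerivAt (fun x ↦ fderiv ℝ ψ x e₁ • e₀ - fderiv ℝ ψ x e₀ • e₁) _ x :=
      ((hdir e₁ x).smul_const e₀).sub ((hdir e₀ x).smul_const e₁)
    rw [h.fderiv]
    simp only [sub_apply, ContinuousLinearMap.smulRight_apply,
      ContinuousLinearMap.flip_apply, PiLp.sub_apply, PiLp.smul_apply, smul_eq_mul,
      Finset.sum_sub_distrib]
    simp only [e₀, e₁, PiLp.single_apply, mul_ite, mul_one, mul_zero, Finset.sum_ite_eq',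
      Finset.mem_univ, if_true]
    rw [hsymm.eq, sub_self]
  · intro h0
    have hd (x : EuclideanSpace ℝ (Fin n)) : fderiv ℝ ψ x e₁ = 0 := by
      simpa [e₀, e₁, hi] using congrArg (fun w : EuclideanSpace ℝ (Fin n) ↦ w i₀) (congrFun h0 x)
    -- `ψ` is then constant along the line `x₀ + ℝ e₁`, which leaves its support
    have hline (t : ℝ) : HasDerivAt (fun s : ℝ ↦ ψ (x₀ + s • e₁)) 0 t := by
      have h1 : HasDerivAt (fun s : ℝ ↦ x₀ + s • e₁) e₁ t := by
        simpa using ((hasDerivAt_id t).smul_const e₁).const_add x₀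
      have h2 := ((hψ.differentiable (by simp)) (x₀ + t • e₁)).hasFDerivAt.comp_hasDerivAt t h1
      rwa [hd] at h2
    have hc := is_const_of_deriv_eq_zero (fun t ↦ (hline t).differentiableAt)
      (fun t ↦ (hline t).deriv) 0 ρ
    have h1 : ψ (x₀ + ρ • e₁) = 0 := by
      refine ψ.zero_of_le_dist ?_
      simp [e₁, norm_smul, abs_of_pos hρ, ψ]
    have h2 : ψ x₀ = 1 := ψ.one_of_mem_closedBall (by simp [ψ]; positivity)
    simp [h1, h2] at hc

namespace SpaceV

lemma exists_val_ne_zero (hn : 2 ≤ n) (hO : IsOpen O) (hne : O.Nonempty) :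
    ∃ u : SpaceV O, u.val ≠ 0 := by
  obtain ⟨φ, hφ, hφ0⟩ := exists_isTestField_ne_zero hn hO hne
  refine ⟨hφ.toSpaceV, fun h ↦ hφ0 ?_⟩
  have h1 : φ =ᵐ[volume.restrict O] 0 :=
    ((hφ.memLp 2).coeFn_toLp.symm.trans (by rw [show (hφ.memLp 2).toLp φ = 0 from h])).trans
      (Lp.coeFn_zero _ _ _)
  have h2 : Set.EqOn φ 0 O := Measure.eqOn_open_of_ae_eq h1 hO
    hφ.smooth.continuous.continuousOn continuousOn_const
  ext1 x
  by_cases hx : x ∈ O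
  · exact h2 hx
  · exact hφ.eq_zero_of_notMem hx

/-- The infimum of the Rayleigh quotient is attained. A minimizing sequence converges in `L²`
along a subsequence, by compactness; by the parallelogram identity it then converges in `𝕍`. -/
theorem exists_rayleigh_minimizer (hO : IsOpen O) (hOb : Bornology.IsBounded O)
    (hV : ∃ u : SpaceV O, u.val ≠ 0) :
    ∃ e : SpaceV O, ‖e.val‖ = 1 ∧ ∀ u : SpaceV O, ‖gradL e‖ ^ 2 * ‖u.val‖ ^ 2 ≤ ‖gradL u‖ ^ 2 := by
  set R : Set ℝ := (fun u : SpaceV O ↦ ‖gradL u‖ ^ 2) '' {u | ‖u.val‖ = 1}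
  have hscale (u : SpaceV O) (hu : u.val ≠ 0) : ‖(‖u.val‖⁻¹ • u).val‖ = 1 := by
    rw [← valL_apply, map_smul, valL_apply, norm_smul, norm_inv, norm_norm,
      inv_mul_cancel₀ (norm_ne_zero_iff.2 hu)]
  have hR : R.Nonempty := by
    obtain ⟨u, hu⟩ := hV
    exact ⟨_, _, hscale u hu, rfl⟩
  have hRb : BddBelow R := ⟨0, by rintro - ⟨u, -, rfl⟩; positivity⟩
  set m := sInf R
  have hm (u : SpaceV O) : m * ‖u.val‖ ^ 2 ≤ ‖gradL u‖ ^ 2 := by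
    by_cases hu : u.val = 0
    · rw [hu, norm_zero]; simp
    · have h := csInf_le hRb ⟨_, hscale u hu, rfl⟩
      simp only [map_smul, norm_smul, norm_inv, norm_norm, mul_pow, inv_pow] at h
      have hpos : 0 < ‖u.val‖ ^ 2 := by positivity
      rwa [inv_mul_eq_div, le_div_iff₀ hpos] at h
  obtain ⟨ρ, -, hρlim, hρ⟩ := exists_seq_tendsto_sInf hR hRb
  choose u hu1 huρ using hρ
  have hu1' (k : ℕ) : ‖(u k).val‖ = 1 := hu1 k
  replace huρ : Tendsto (fun k ↦ ‖gradL (u k)‖ ^ 2) atTop (𝓝 m) := by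
    simpa only [huρ] using hρlim
  obtain ⟨M, hM⟩ := huρ.bddAbove_range
  have hbd (k : ℕ) : ‖u k‖ ≤ 1 + M := by
    have h1 : ‖gradL (u k)‖ ^ 2 ≤ M := hM ⟨k, rfl⟩
    have h2 := norm_sq_eq (u k)
    rw [hu1' k] at h2
    nlinarith [norm_nonneg (u k), sq_nonneg ‖gradL (u k)‖]
  obtain ⟨a, -, θ, hθ, ha⟩ := ((totallyBounded_val_image hO hOb
    (1 + M)).closure.isCompact_of_isClosed isClosed_closure).tendsto_subseq (fun k ↦ subset_closure ⟨u k, hbd k, rfl⟩)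
  have hcau : CauchySeq (fun k ↦ u (θ k)) := by
    have hva : CauchySeq (fun k ↦ (u (θ k)).val) := ha.cauchySeq
    have hgr : Tendsto (fun k ↦ ‖gradL (u (θ k))‖ ^ 2) atTop (𝓝 m) := huρ.comp hθ.tendsto_atTop
    have hva2 : Tendsto (fun k : ℕ × ℕ ↦ ‖(u (θ k.1)).val - (u (θ k.2)).val‖ ^ 2) atTop (𝓝 0) := by
      have := (cauchySeq_iff_tendsto_dist_atTop_0.1 hva).pow 2
      simpa [dist_eq_norm] using this
    rw [cauchySeq_iff_tendsto_dist_atTop_0]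
    have hlim : Tendsto (fun k : ℕ × ℕ ↦ (1 + m) * ‖(u (θ k.1)).val - (u (θ k.2)).val‖ ^ 2 +
        (2 * ‖gradL (u (θ k.1))‖ ^ 2 + 2 * ‖gradL (u (θ k.2))‖ ^ 2 - 4 * m)) atTop (𝓝 0) := by
      have h1 : Tendsto (fun k : ℕ × ℕ ↦ ‖gradL (u (θ k.1))‖ ^ 2) atTop (𝓝 m) := by
        rw [← prod_atTop_atTop_eq]; exact hgr.comp tendsto_fst
      have h2 : Tendsto (fun k : ℕ × ℕ ↦ ‖gradL (u (θ k.2))‖ ^ 2) atTop (𝓝 m) := by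
        rw [← prod_atTop_atTop_eq]; exact hgr.comp tendsto_snd
      have := (hva2.const_mul (1 + m)).add
        (((h1.const_mul 2).add (h2.const_mul 2)).sub_const (4 * m))
      convert! this using 2
      ring
    have hsq : Tendsto (fun k : ℕ × ℕ ↦ dist (u (θ k.1)) (u (θ k.2)) ^ 2) atTop (𝓝 0) := by
      refine squeeze_zero (fun _ ↦ by positivity) (fun k ↦ ?_) hlim
      set x := u (θ k.1)
      set y := u (θ k.2)
      have hp1 := parallelogram_law_with_norm ℝ x.val y.val
      have hp2 := parallelogram_law_with_norm ℝ (gradL x) (gradL y)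
      have hx : ‖x.val‖ = 1 := hu1' _
      have hy : ‖y.val‖ = 1 := hu1' _
      have h3 := hm (x + y)
      have h4 := norm_sq_eq (x - y)
      rw [← valL_apply, map_add, map_add, valL_apply, valL_apply] at h3
      rw [← valL_apply, map_sub, map_sub, valL_apply, valL_apply] at h4
      rw [dist_eq_norm, h4]
      rw [hx, hy] at hp1
      have h5 : ‖x.val + y.val‖ ^ 2 = 4 - ‖x.val - y.val‖ ^ 2 := by linarith
      rw [h5] at h3
      linarith
    have := hsq.sqrt
    simpa [Real.sqrt_sq dist_nonneg] using this
  obtain ⟨e, he⟩ := cauchySeq_tendsto_of_complete hcau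
  have he1 : ‖e.val‖ = 1 := by
    have h : Tendsto (fun k ↦ ‖(u (θ k)).val‖) atTop (𝓝 ‖e.val‖) :=
      ((valL.continuous.tendsto e).comp he).norm
    simp only [hu1'] at h
    exact tendsto_nhds_unique h tendsto_const_nhds |>.symm ▸ rfl
  have hem : ‖gradL e‖ ^ 2 = m := by
    have h : Tendsto (fun k ↦ ‖gradL (u (θ k))‖ ^ 2) atTop (𝓝 (‖gradL e‖ ^ 2)) :=
      (((gradL.continuous.tendsto e).comp he).norm).pow 2
    exact tendsto_nhds_unique h (huρ.comp hθ.tendsto_atTop)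
  exact ⟨e, he1, fun v ↦ hem ▸ hm v⟩

/-- A minimizer of the Rayleigh quotient solves the eigenvalue equation. -/
lemma stokes_eq_of_rayleigh_minimizer {e : SpaceV O} (he : ‖e.val‖ = 1)
    (hmin : ∀ u : SpaceV O, ‖gradL e‖ ^ 2 * ‖u.val‖ ^ 2 ≤ ‖gradL u‖ ^ 2) (v : SpaceV O) :
    e.stokes v = ‖gradL e‖ ^ 2 * inner ℝ e.val v.val := by
  rw [stokes_eq_inner]
  set m := ‖gradL e‖ ^ 2
  set q := inner ℝ (gradL e) (gradL v) - m * inner ℝ e.val v.val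
  set Q := ‖gradL v‖ ^ 2 - m * ‖v.val‖ ^ 2
  have hQ : 0 ≤ Q := sub_nonneg.2 (hmin v)
  have hq (t : ℝ) : 0 ≤ 2 * t * q + t ^ 2 * Q := by
    have h := hmin (e + t • v)
    rw [← valL_apply, map_add, map_smul, map_add, map_smul, valL_apply, valL_apply,
      norm_add_sq_real, norm_add_sq_real, he, inner_smul_right, inner_smul_right, norm_smul,
      norm_smul, mul_pow, mul_pow, Real.norm_eq_abs, sq_abs] at h
    simp only [q, Q]
    linarith
  have h := hq (-q / (Q + 1))
  have h1 : 2 * (-q / (Q + 1)) * q + (-q / (Q + 1)) ^ 2 * Q = -(q ^ 2 * (Q + 2)) / (Q + 1) ^ 2 := by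
    field_simp
    ring
  rw [h1, div_nonneg_iff] at h
  have h2 : q ^ 2 ≤ 0 := by
    rcases h with h | h
    · nlinarith [sq_nonneg q]
    · nlinarith [sq_nonneg q]
  have h3 : q = 0 := by nlinarith
  exact sub_eq_zero.1 h3

/-- The smallest Stokes eigenvalue is positive and is the optimal constant in Poincaré's
inequality. -/
theorem stokesLambda1_pos_and_le (hn : 2 ≤ n) (hO : IsOpen O) (hne : O.Nonempty)
    (hOb : Bornology.IsBounded O) :
    0 < stokesLambda1 O ∧ ∀ u : SpaceV O, stokesLambda1 O * ‖u.val‖ ^ 2 ≤ ‖gradL u‖ ^ 2 := by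
  obtain ⟨e, he, hmin⟩ := exists_rayleigh_minimizer hO hOb (exists_val_ne_zero hn hO hne)
  have hleast : IsLeast {ℓ | IsStokesEigenvalue O ℓ} (‖gradL e‖ ^ 2) := by
    refine ⟨⟨e, ?_, stokes_eq_of_rayleigh_minimizer he hmin⟩, ?_⟩
    · rintro rfl
      have : (0 : SpaceV O).val = 0 := rfl
      simp [this] at he
    · rintro ℓ ⟨w, hw, hℓ⟩
      have h1 := hℓ w
      rw [stokes_eq_inner, real_inner_self_eq_norm_sq, real_inner_self_eq_norm_sq] at h1
      have h2 := hmin w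
      have h3 : 0 < ‖w.val‖ ^ 2 := by
        rw [sq_pos_iff, norm_ne_zero_iff]
        intro h0
        have h4 := norm_sq_eq w
        rw [h1, h0] at h4
        simp at h4
        exact hw h4
      rw [h1] at h2
      exact le_of_mul_le_mul_right h2 h3
  rw [stokesLambda1, hleast.csInf_eq]
  refine ⟨?_, hmin⟩
  obtain ⟨C, hC, hP⟩ := exists_poincare (O := O) (by omega) hO hOb
  have := hP e
  rw [he] at this
  by_contra! h
  nlinarith

end SpaceV

end FirstEigenvalue

/-! ### An energy inequality from backward differences in time -/

section TimeAverages

variable {X Y : Type*} [NormedAddCommGroup X] [NormedSpace ℝ X] [NormedAddCommGroup Y]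
  [NormedSpace ℝ Y] (B : X →L[ℝ] Y →L[ℝ] ℝ)

lemma tendsto_inv_mul_integral_zero {F : ℝ → ℝ} (hF : Continuous F) :
    Tendsto (fun h : ℝ ↦ h⁻¹ * ∫ τ in (0 : ℝ)..h, F τ) (𝓝[>] 0) (𝓝 (F 0)) := by
  have h := (hF.integral_hasStrictDerivAt 0 0).hasDerivAt.tendsto_slope_zero_right
  simpa using h

/-- For `g ∈ L^q(ℝ; X)`, `z ∈ L^p(ℝ; Y)` with conjugate exponents, the pairing of `z` with the
translates of `g` depends continuously on the translation. -/
lemma continuous_integral_translate_apply {p q : ℝ≥0∞} [Fact (1 ≤ p)] [Fact (1 ≤ q)]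
    [ENNReal.HolderConjugate q p] (hq : q ≠ ⊤) {g : ℝ → X} {z : ℝ → Y}
    (hg : MemLp g q) (hz : MemLp z p) : Continuous fun τ : ℝ ↦ ∫ t, B (g (t - τ)) (z t) := by
  let T : ℝ → C(ℝ, ℝ) := (ContinuousMap.curry ⟨fun x : ℝ × ℝ ↦ x.2 - x.1, by fun_prop⟩)
  have hT : Continuous T := ContinuousMap.continuous _
  have hTm (τ : ℝ) : MeasurePreserving (T τ) volume volume := measurePreserving_sub_right volume τ
  have hc : Continuous fun τ ↦ B.lpPairing volume q p
      (Lp.compMeasurePreserving (T τ) (hTm τ) hg.toLp) hz.toLp :=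
    ((B.lpPairing volume q p).continuous.comp
      (continuous_const.compMeasurePreservingLp hT hTm hq)).clm_apply continuous_const
  convert hc using 2 with τ
  rw [ContinuousLinearMap.lpPairing_eq_integral]
  refine integral_congr_ae ?_
  filter_upwards [Lp.coeFn_compMeasurePreserving hg.toLp (hTm τ), hz.coeFn_toLp,
    (hTm τ).quasiMeasurePreserving.ae hg.coeFn_toLp] with t h1 h2 h3
  rw [h1, h2, Function.comp_apply, h3]
  rfl

lemma aestronglyMeasurable_translate_apply {g : ℝ → X} {z : ℝ → Y}
    (hg : AEStronglyMeasurable g) (hz : AEStronglyMeasurable z) (h : ℝ) :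
    AEStronglyMeasurable (fun x : ℝ × ℝ ↦ B (g (x.2 - x.1)) (z x.2))
      ((volume.restrict (Set.Ioc 0 h)).prod volume) := by
  have h1 : Measure.QuasiMeasurePreserving (fun x : ℝ × ℝ ↦ x.2 - x.1)
      ((volume.restrict (Set.Ioc 0 h)).prod volume) volume := by
    have h2 : Measure.QuasiMeasurePreserving (fun x : ℝ × ℝ ↦ x.2 - x.1)
        (volume.prod volume) volume := by
      exact (quasiMeasurePreserving_sub_of_right_invariant volume volume).comp
        Measure.measurePreserving_swap.quasiMeasurePreserving
    refine h2.mono_left ?_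
    exact Measure.AbsolutelyContinuous.prod Measure.restrict_le_self.absolutelyContinuous
      Measure.AbsolutelyContinuous.rfl
  exact B.aestronglyMeasurable_comp₂
    (hg.comp_quasiMeasurePreserving h1) (hz.comp_quasiMeasurePreserving
      Measure.quasiMeasurePreserving_snd)

lemma integrable_translate_apply {p q : ℝ≥0∞} [Fact (1 ≤ p)] [Fact (1 ≤ q)]
    [ENNReal.HolderConjugate q p] {g : ℝ → X} {z : ℝ → Y}
    (hg : MemLp g q) (hz : MemLp z p) (h : ℝ) :
    Integrable (fun x : ℝ × ℝ ↦ B (g (x.2 - x.1)) (z x.2))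
      ((volume.restrict (Set.Ioc 0 h)).prod volume) := by
  have hm := aestronglyMeasurable_translate_apply B hg.1 hz.1 h
  refine ⟨hm, ?_⟩
  rw [HasFiniteIntegral, lintegral_prod _ hm.enorm]
  have hb (τ : ℝ) : ∫⁻ t, ‖B (g (t - τ)) (z t)‖ₑ ≤
      ‖B‖₊ * eLpNorm g q volume * eLpNorm z p volume := by
    have hτ := measurePreserving_sub_right volume τ
    have h1 := eLpNorm_le_eLpNorm_mul_eLpNorm_of_nnnorm (r := 1) (p := q) (q := p)
      (hg.1.comp_measurePreserving hτ) hz.1 (fun x y ↦ B x y) ‖B‖₊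
      (ae_of_all _ fun t ↦ B.le_opNorm₂ _ _)
    rwa [eLpNorm_one_eq_lintegral_enorm, eLpNorm_comp_measurePreserving hg.1 hτ] at h1
  refine (lintegral_mono fun τ ↦ hb τ).trans_lt ?_
  rw [lintegral_const]
  refine ENNReal.mul_lt_top (ENNReal.mul_lt_top (ENNReal.mul_lt_top (by simp) hg.2) hz.2) ?_
  simp

/-- The pairing of `z(t)` with the backward average of `g` over `(t - h, t)` converges to the
pairing of `z` with `g`, as `h → 0⁺`. -/
theorem tendsto_integral_backward_average {p q : ℝ≥0∞} [Fact (1 ≤ p)] [Fact (1 ≤ q)]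
    [ENNReal.HolderConjugate q p] (hq : q ≠ ⊤) {g : ℝ → X} {z : ℝ → Y}
    (hg : MemLp g q) (hz : MemLp z p) :
    (∀ h : ℝ, 0 < h → Integrable fun t ↦ ∫ s in (t - h)..t, B (g s) (z t)) ∧
    Tendsto (fun h : ℝ ↦ h⁻¹ * ∫ t, ∫ s in (t - h)..t, B (g s) (z t)) (𝓝[>] 0)
      (𝓝 (∫ t, B (g t) (z t))) := by
  have hcv (h : ℝ) (hh : 0 < h) (t : ℝ) : ∫ s in (t - h)..t, B (g s) (z t) =
      ∫ τ in Set.Ioc 0 h, B (g (t - τ)) (z t) := by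
    rw [← intervalIntegral.integral_of_le hh.le,
      intervalIntegral.integral_comp_sub_left (fun s ↦ B (g s) (z t)) t, sub_zero]
  refine ⟨fun h hh ↦ ?_, ?_⟩
  · simp_rw [hcv h hh]
    exact (integrable_translate_apply B hg hz h).integral_prod_right
  · have hF := continuous_integral_translate_apply B hq hg hz
    have := tendsto_inv_mul_integral_zero hF
    simp only [sub_zero] at this
    refine this.congr' ?_
    filter_upwards [self_mem_nhdsWithin] with h hh
    simp_rw [hcv h hh]
    rw [intervalIntegral.integral_of_le (le_of_lt hh), integral_integral_swap
      (integrable_translate_apply B hg hz h)]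

/-- Cutting `g` off to `(0, b]` and `z` to `(a, b]` does not affect backward averages of length
`h < a` at times in `(a, b]`. -/
lemma integral_backward_indicator (g : ℝ → X) (z : ℝ → Y) {a b h : ℝ}
    (hh : 0 < h) (hha : h < a) :
    (fun t ↦ ∫ s in (t - h)..t, B ((Set.Ioc 0 b).indicator g s) ((Set.Ioc a b).indicator z t)) =
      (Set.Ioc a b).indicator fun t ↦ ∫ s in (t - h)..t, B (g s) (z t) := by
  ext t
  by_cases ht : t ∈ Set.Ioc a b
  · rw [Set.indicator_of_mem ht, Set.indicator_of_mem ht]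
    refine intervalIntegral.integral_congr_ae (ae_of_all _ fun s hs ↦ ?_)
    rw [Set.uIoc_of_le (by linarith)] at hs
    have hs' : s ∈ Set.Ioc 0 b := ⟨by linarith [hs.1, ht.1], hs.2.trans ht.2⟩
    rw [Set.indicator_of_mem hs']
  · rw [Set.indicator_of_notMem ht, Set.indicator_of_notMem ht]
    simp

lemma indicator_apply_indicator (g : ℝ → X) (z : ℝ → Y) {a b : ℝ} (ha : 0 < a) :
    (fun t ↦ B ((Set.Ioc 0 b).indicator g t) ((Set.Ioc a b).indicator z t)) =
      (Set.Ioc a b).indicator fun t ↦ B (g t) (z t) := by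
  ext t
  by_cases ht : t ∈ Set.Ioc a b
  · rw [Set.indicator_of_mem ht, Set.indicator_of_mem ht,
      Set.indicator_of_mem (Set.Ioc_subset_Ioc_left ha.le ht)]
  · rw [Set.indicator_of_notMem ht, Set.indicator_of_notMem ht, map_zero]

/-- The same on a bounded time interval: only times in `(0, b]` enter as long as `h < a`. -/
theorem tendsto_setIntegral_backward_average {p q : ℝ≥0∞} [Fact (1 ≤ p)] [Fact (1 ≤ q)]
    [ENNReal.HolderConjugate q p] (hq : q ≠ ⊤) {g : ℝ → X} {z : ℝ → Y} {a b : ℝ}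
    (ha : 0 < a) (hg : MemLp g q (volume.restrict (Set.Ioc 0 b)))
    (hz : MemLp z p (volume.restrict (Set.Ioc 0 b))) :
    (∀ h : ℝ, 0 < h → h < a →
      IntegrableOn (fun t ↦ ∫ s in (t - h)..t, B (g s) (z t)) (Set.Ioc a b)) ∧
    Tendsto (fun h : ℝ ↦ h⁻¹ * ∫ t in Set.Ioc a b, ∫ s in (t - h)..t, B (g s) (z t)) (𝓝[>] 0)
      (𝓝 (∫ t in Set.Ioc a b, B (g t) (z t))) := by
  have hsub : Set.Ioc a b ⊆ Set.Ioc 0 b := Set.Ioc_subset_Ioc_left ha.le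
  have hg' : MemLp ((Set.Ioc 0 b).indicator g) q volume := by
    rw [memLp_indicator_iff_restrict measurableSet_Ioc]
    exact hg
  have hz' : MemLp ((Set.Ioc a b).indicator z) p volume := by
    rw [memLp_indicator_iff_restrict measurableSet_Ioc]
    exact hz.mono_measure (Measure.restrict_mono hsub le_rfl)
  obtain ⟨h1, h2⟩ := tendsto_integral_backward_average B hq hg' hz'
  refine ⟨fun h hh hha ↦ ?_, ?_⟩
  · have := h1 h hh
    rwa [integral_backward_indicator B g z hh hha,
      integrable_indicator_iff measurableSet_Ioc] at this
  · rw [indicator_apply_indicator B g z ha, integral_indicator measurableSet_Ioc] at h2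
    refine h2.congr' ?_
    filter_upwards [Ioo_mem_nhdsGT ha] with h hh
    rw [integral_backward_indicator B g z hh.1 hh.2, integral_indicator measurableSet_Ioc]

/-- If the backward differences of `y` are bounded by the integrals of `B₁(g₁(s), z₁(t))`
and `B₂(g₂(s), z₂(t))` over `t - h < s < t`, then the increments of `y` are bounded by the integrals
of `B₁(g₁, z₁) + B₂(g₂, z₂)`. -/
theorem sub_le_integral_of_backward_difference_le {X₁ Y₁ X₂ Y₂ : Type*} [NormedAddCommGroup X₁]
    [NormedSpace ℝ X₁] [NormedAddCommGroup X₂] [NormedSpace ℝ X₂] [NormedAddCommGroup Y₁]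
    [NormedSpace ℝ Y₁] [NormedAddCommGroup Y₂] [NormedSpace ℝ Y₂]
    (B₁ : X₁ →L[ℝ] Y₁ →L[ℝ] ℝ) (B₂ : X₂ →L[ℝ] Y₂ →L[ℝ] ℝ) {p₁ q₁ p₂ q₂ : ℝ≥0∞}
    [Fact (1 ≤ p₁)] [Fact (1 ≤ q₁)] [Fact (1 ≤ p₂)] [Fact (1 ≤ q₂)]
    [ENNReal.HolderConjugate q₁ p₁] [ENNReal.HolderConjugate q₂ p₂] (hq₁ : q₁ ≠ ⊤) (hq₂ : q₂ ≠ ⊤)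
    {y : ℝ → ℝ} (hy : Continuous y) {a b : ℝ} (ha : 0 < a) (hab : a ≤ b)
    {g₁ : ℝ → X₁} {z₁ : ℝ → Y₁} {g₂ : ℝ → X₂} {z₂ : ℝ → Y₂}
    (hg₁ : MemLp g₁ q₁ (volume.restrict (Set.Ioc 0 b)))
    (hz₁ : MemLp z₁ p₁ (volume.restrict (Set.Ioc 0 b)))
    (hg₂ : MemLp g₂ q₂ (volume.restrict (Set.Ioc 0 b)))
    (hz₂ : MemLp z₂ p₂ (volume.restrict (Set.Ioc 0 b)))
    (hdiff : ∀ h : ℝ, 0 < h → h < a → ∀ᵐ t ∂(volume.restrict (Set.Ioc a b)), y t - y (t - h) ≤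
      (∫ s in (t - h)..t, B₁ (g₁ s) (z₁ t)) + ∫ s in (t - h)..t, B₂ (g₂ s) (z₂ t)) :
    y b - y a ≤ (∫ t in Set.Ioc a b, B₁ (g₁ t) (z₁ t)) + ∫ t in Set.Ioc a b, B₂ (g₂ t) (z₂ t) := by
  obtain ⟨hi₁, hl₁⟩ := tendsto_setIntegral_backward_average B₁ hq₁ ha hg₁ hz₁
  obtain ⟨hi₂, hl₂⟩ := tendsto_setIntegral_backward_average B₂ hq₂ ha hg₂ hz₂
  have hlim (c : ℝ) : Tendsto (fun h : ℝ ↦ h⁻¹ * ∫ s in (c - h)..c, y s) (𝓝[>] 0) (𝓝 (y c)) := by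
    have := tendsto_inv_mul_integral_zero (F := fun τ ↦ y (c - τ)) (by fun_prop)
    simpa [intervalIntegral.integral_comp_sub_left y c] using this
  refine le_of_tendsto_of_tendsto ((hlim b).sub (hlim a)) (hl₁.add hl₂) ?_
  filter_upwards [Ioo_mem_nhdsGT ha] with h hh
  rw [← mul_sub, ← mul_add]
  refine mul_le_mul_of_nonneg_left ?_ (inv_nonneg.2 hh.1.le)
  have hyi (c d : ℝ) : IntervalIntegrable y volume c d := hy.intervalIntegrable c d
  have hyi' : IntervalIntegrable (fun t ↦ y (t - h)) volume a b :=
    (by fun_prop : Continuous fun t ↦ y (t - h)).intervalIntegrable a b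
  have hshift : (∫ s in (b - h)..b, y s) - ∫ s in (a - h)..a, y s =
      ∫ t in a..b, (y t - y (t - h)) := by
    rw [intervalIntegral.integral_sub (hyi _ _) hyi', intervalIntegral.integral_comp_sub_right y h,
      intervalIntegral.integral_interval_sub_interval_comm (hyi _ _) (hyi _ _) (hyi _ _),
      intervalIntegral.integral_symm b a, intervalIntegral.integral_symm (b - h) (a - h)]
    ring
  rw [hshift, intervalIntegral.integral_of_le hab,
    ← integral_add (hi₁ h hh.1 hh.2) (hi₂ h hh.1 hh.2)]
  refine integral_mono_ae ?_ ((hi₁ h hh.1 hh.2).add (hi₂ h hh.1 hh.2)) (hdiff h hh.1 hh.2)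
  exact ((intervalIntegrable_iff_integrableOn_Ioc_of_le hab).1 (hyi a b)).sub
    ((intervalIntegrable_iff_integrableOn_Ioc_of_le hab).1 hyi')

end TimeAverages

/-! ### The convection term -/

section Inclusion

variable {α E : Type*} {m : MeasurableSpace α} {μ : Measure α} [IsFiniteMeasure μ]
  [NormedAddCommGroup E] [NormedSpace ℝ E] {p q : ℝ≥0∞} [Fact (1 ≤ p)] [Fact (1 ≤ q)]

/-- The inclusion `L^p ⊆ L^q`, `q ≤ p`, over a finite measure. -/
def lpInclusion (hpq : q ≤ p) : Lp E p μ →L[ℝ] Lp E q μ :=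
  LinearMap.mkContinuous
    { toFun := fun f ↦ ((Lp.memLp f).mono_exponent hpq).toLp f
      map_add' := fun f g ↦ by
        rw [← MemLp.toLp_add]
        exact MemLp.toLp_congr _ _ (Lp.coeFn_add f g)
      map_smul' := fun c f ↦ by
        rw [RingHom.id_apply, ← MemLp.toLp_const_smul]
        exact MemLp.toLp_congr _ _ (Lp.coeFn_smul c f) }
    (μ Set.univ ^ (1 / q.toReal - 1 / p.toReal)).toReal fun f ↦ by
      have hq : 0 < q := zero_lt_one.trans_le Fact.out
      have hfin : μ Set.univ ^ (1 / q.toReal - 1 / p.toReal) ≠ ⊤ := by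
        refine ENNReal.rpow_ne_top_of_nonneg ?_ (measure_ne_top μ _)
        rw [sub_nonneg]
        by_cases hp : p = ⊤
        · simp [hp]
        · exact one_div_le_one_div_of_le (ENNReal.toReal_pos hq.ne' (ne_top_of_le_ne_top hp hpq))
            (ENNReal.toReal_mono hp hpq)
      have h := eLpNorm_le_eLpNorm_mul_rpow_measure_univ hpq (Lp.memLp f).1
      simp only [LinearMap.coe_mk, AddHom.coe_mk, Lp.norm_toLp]
      rw [Lp.norm_def, mul_comm, ← ENNReal.toReal_mul]
      exact ENNReal.toReal_mono (ENNReal.mul_ne_top (Lp.eLpNorm_ne_top f) hfin) h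

lemma coeFn_lpInclusion (hpq : q ≤ p) (f : Lp E p μ) :
    (lpInclusion hpq f : Lp E q μ) =ᵐ[μ] f :=
  MemLp.coeFn_toLp ((Lp.memLp f).mono_exponent hpq)

end Inclusion

section Convection

set_option maxSynthPendingDepth 3

variable {n : ℕ} {O : Set (EuclideanSpace ℝ (Fin n))}

instance : Fact (1 ≤ (4 : ℝ≥0∞)) := ⟨by norm_num⟩

instance : ENNReal.HolderTriple 4 4 2 where
  inv_add_inv_eq_inv := by
    rw [← two_mul, show (4 : ℝ≥0∞) = 2 * 2 by norm_num, ENNReal.mul_inv (by simp) (by simp),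
      ← mul_assoc, ENNReal.mul_inv_cancel (by simp) (by simp), one_mul]

/-- The bilinear map `(x, y) ↦ xᵢ y`. -/
def coordSMul (i : Fin n) : EuclideanSpace ℝ (Fin n) →L[ℝ] EuclideanSpace ℝ (Fin n) →L[ℝ]
    EuclideanSpace ℝ (Fin n) :=
  (ContinuousLinearMap.lsmul ℝ ℝ).comp (EuclideanSpace.proj i)

@[simp] lemma coordSMul_apply (i : Fin n) (x y : EuclideanSpace ℝ (Fin n)) :
    coordSMul i x y = x i • y := rfl

/-- The trilinear form `(a, g, c) ↦ ∫_O ∑ᵢ aᵢ gᵢ · c` on `L⁴ × (L²)ⁿ × L⁴`, as a bilinear map into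
the dual of `L⁴`. -/
def convectionL (O : Set (EuclideanSpace ℝ (Fin n))) :
    VecLp O 4 →L[ℝ] PiLp 2 (fun _ : Fin n => VecLp O 2) →L[ℝ] StrongDual ℝ (VecLp O 4) :=
  ∑ i, (ContinuousLinearMap.compL ℝ (VecLp O 4) (VecLp O 2) ℝ).flip.bilinearComp
    ((coordSMul i).holderL (volume.restrict O) 4 4 2)
    ((innerSL ℝ : VecLp O 2 →L[ℝ] StrongDual ℝ (VecLp O 2)).comp
      (PiLp.proj 2 (fun _ : Fin n => VecLp O 2) i))

lemma convectionL_apply (a : VecLp O 4) (g : PiLp 2 (fun _ : Fin n => VecLp O 2))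
    (c : VecLp O 4) : convectionL O a g c =
      ∑ i, inner ℝ (g i) ((coordSMul i).holder 2 a c : VecLp O 2) := by
  rw [convectionL, sum_apply, sum_apply, sum_apply]
  rfl

lemma integrable_convection (a : VecLp O 4) (g : PiLp 2 (fun _ : Fin n => VecLp O 2))
    (c : VecLp O 4) (i : Fin n) :
    IntegrableOn (fun x ↦ a x i * inner ℝ (g i x) (c x)) O := by
  refine (L2.integrable_inner (𝕜 := ℝ) (g i) ((coordSMul i).holder 2 a c : VecLp O 2)).congr ?_
  filter_upwards [(coordSMul i).coeFn_holder (r := 2) a c] with x hx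
  rw [hx, coordSMul_apply, inner_smul_right]

lemma convectionL_eq_integral (a : VecLp O 4) (g : PiLp 2 (fun _ : Fin n => VecLp O 2))
    (c : VecLp O 4) :
    convectionL O a g c = ∫ x in O, ∑ i, a x i * inner ℝ (g i x) (c x) := by
  rw [convectionL_apply, integral_finsetSum _ fun i _ ↦ integrable_convection a g c i]
  refine Finset.sum_congr rfl fun i _ ↦ ?_
  rw [L2.inner_def]
  refine integral_congr_ae ?_
  filter_upwards [(coordSMul i).coeFn_holder (r := 2) a c] with x hx
  rw [hx, coordSMul_apply, inner_smul_right]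

lemma SpaceV.convection_eq_convectionL {u v : SpaceV O} {a c : VecLp O 4}
    (ha : a =ᵐ[volume.restrict O] u.val) (hc : c =ᵐ[volume.restrict O] v.val) :
    u.convection v = convectionL O a (gradL u) c := by
  rw [convectionL_eq_integral, convection]
  refine integral_congr_ae ?_
  filter_upwards [ha, hc] with x h1 h2
  rw [h1, h2]
  rfl

/-- `∫ (φ · ∇)ψ · ψ = ½ ∫ φ · ∇|ψ|² = 0` for divergence-free `φ`. -/
lemma IsTestField.integral_convection_eq_zero
    {φ ψ : EuclideanSpace ℝ (Fin n) → EuclideanSpace ℝ (Fin n)} (hφ : IsTestField O φ)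
    (hψ : IsTestField O ψ) :
    ∫ x in O, ∑ i, φ x i * inner ℝ (fderiv ℝ ψ x (EuclideanSpace.single i 1)) (ψ x) = 0 := by
  obtain ⟨e, he⟩ : ∃ e : Fin n → EuclideanSpace ℝ (Fin n), ∀ i, e i = EuclideanSpace.single i 1 :=
    ⟨_, fun _ ↦ rfl⟩
  have hdiv (x) : ∑ i, fderiv ℝ φ x (e i) i = 0 := by
    simp_rw [he, hφ.div_eq_zero x]
  simp_rw [← he]
  have hφi (i : Fin n) (x) : HasFDerivAt (fun x ↦ φ x i)
      ((EuclideanSpace.proj i : EuclideanSpace ℝ (Fin n) →L[ℝ] ℝ).comp (fderiv ℝ φ x)) x :=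
    (EuclideanSpace.proj i : EuclideanSpace ℝ (Fin n) →L[ℝ] ℝ).hasFDerivAt.comp x
      (hφ.differentiable x).hasFDerivAt
  have hψ2 (x) : HasFDerivAt (fun x ↦ ‖ψ x‖ ^ 2) (2 • (innerSL ℝ (ψ x)).comp (fderiv ℝ ψ x)) x :=
    (hψ.differentiable x).hasFDerivAt.norm_sq
  have hdφ (i : Fin n) (x v) : fderiv ℝ (fun x ↦ φ x i) x v = fderiv ℝ φ x v i := by
    rw [(hφi i x).fderiv]; rfl
  have hdψ (x v) : fderiv ℝ (fun x ↦ ‖ψ x‖ ^ 2) x v = 2 * inner ℝ (fderiv ℝ ψ x v) (ψ x) := by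
    rw [(hψ2 x).fderiv, real_inner_comm]; simp
  have hcφ : Continuous φ := hφ.smooth.continuous
  have hcψ : Continuous ψ := hψ.smooth.continuous
  have hcsφ (i : Fin n) : HasCompactSupport fun x ↦ φ x i :=
    hφ.compactSupport.comp_left (g := fun w : EuclideanSpace ℝ (Fin n) ↦ w i) rfl
  have hcsψ : HasCompactSupport fun x ↦ ‖ψ x‖ ^ 2 :=
    hψ.compactSupport.comp_left (g := fun w : EuclideanSpace ℝ (Fin n) ↦ ‖w‖ ^ 2) (by simp)
  have hcdφ (i : Fin n) : Continuous fun x ↦ fderiv ℝ φ x (e i) i :=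
    (EuclideanSpace.proj i : EuclideanSpace ℝ (Fin n) →L[ℝ] ℝ).continuous.comp
      (hφ.continuous_fderiv_apply (e i))
  have hcdψ (i : Fin n) : Continuous fun x ↦ 2 * inner ℝ (fderiv ℝ ψ x (e i)) (ψ x) :=
    ((hψ.continuous_fderiv_apply (e i)).inner hcψ).const_mul 2
  have hi1 (i : Fin n) : Integrable fun x ↦ φ x i * (2 * inner ℝ (fderiv ℝ ψ x (e i)) (ψ x)) :=
    Continuous.integrable_of_hasCompactSupport
      ((by fun_prop : Continuous fun x ↦ φ x i).mul (hcdψ i))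
      ((hcsφ i).mul_right
      (f' := fun x ↦ 2 * inner ℝ (fderiv ℝ ψ x (e i)) (ψ x)))
  have hi2 (i : Fin n) : Integrable fun x ↦ fderiv ℝ φ x (e i) i * ‖ψ x‖ ^ 2 :=
    Continuous.integrable_of_hasCompactSupport ((hcdφ i).mul (hcψ.norm.pow 2))
      (hcsψ.mul_left (f := fun x ↦ fderiv ℝ φ x (e i) i))
  have hi3 (i : Fin n) : Integrable fun x ↦ φ x i * ‖ψ x‖ ^ 2 :=
    Continuous.integrable_of_hasCompactSupport (by fun_prop) (hcsψ.mul_left (f := fun x ↦ φ x i))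
  have hparts (i : Fin n) : ∫ x, φ x i * (2 * inner ℝ (fderiv ℝ ψ x (e i)) (ψ x)) =
      -∫ x, fderiv ℝ φ x (e i) i * ‖ψ x‖ ^ 2 := by
    have := integral_mul_fderiv_eq_neg_fderiv_mul_of_integrable (𝕜 := ℝ) (μ := volume)
      (f := fun x ↦ φ x i) (g := fun x ↦ ‖ψ x‖ ^ 2) (v := e i)
      (by simpa only [hdφ] using hi2 i) (by simpa only [hdψ] using hi1 i) (hi3 i)
      (fun x _ ↦ (hφi i x).differentiableAt) (fun x _ ↦ (hψ2 x).differentiableAt)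
    simpa only [hdφ, hdψ] using this
  rw [setIntegral_eq_integral_of_forall_compl_eq_zero fun x hx ↦ by
    simp [hφ.eq_zero_of_notMem hx]]
  have h2 : 2 * ∫ x, ∑ i, φ x i * inner ℝ (fderiv ℝ ψ x (e i)) (ψ x) = 0 := by
    rw [← integral_const_mul]
    simp_rw [Finset.mul_sum, mul_left_comm (2 : ℝ)]
    rw [integral_finsetSum _ fun i _ ↦ hi1 i]
    simp_rw [hparts]
    rw [Finset.sum_neg_distrib, ← integral_finsetSum _ fun i _ ↦ hi2 i]
    simp_rw [← Finset.sum_mul, hdiv]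
    simp
  linarith

/-- The same with `ψ` replaced by `w ∈ 𝕍`: for bounded `φ` the form is continuous in the
`H¹`-norm. -/
lemma IsTestField.integral_convection_spaceV_eq_zero
    {φ : EuclideanSpace ℝ (Fin n) → EuclideanSpace ℝ (Fin n)} (hφ : IsTestField O φ)
    (w : SpaceV O) :
    ∫ x in O, ∑ i, φ x i * inner ℝ (w.grad i x) (w.val x) = 0 := by
  set S : Fin n → VecLp O 2 →L[ℝ] VecLp O 2 := fun i ↦
    (coordSMul i).holderL (volume.restrict O) ⊤ 2 2 (hφ.memLp ⊤).toLp
  have hS (i : Fin n) (v : VecLp O 2) : S i v =ᵐ[volume.restrict O] fun x ↦ φ x i • v x := by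
    refine ((coordSMul i).coeFn_holder _ _).trans ?_
    filter_upwards [(hφ.memLp ⊤).coeFn_toLp] with x hx
    rw [hx, coordSMul_apply]
  have hpair (g v : VecLp O 2) (i : Fin n) :
      inner ℝ g (S i v) = ∫ x in O, φ x i * inner ℝ (g x) (v x) := by
    rw [L2.inner_def]
    refine integral_congr_ae ?_
    filter_upwards [hS i v] with x hx
    rw [hx, inner_smul_right]
  have hint (g v : VecLp O 2) (i : Fin n) :
      IntegrableOn (fun x ↦ φ x i * inner ℝ (g x) (v x)) O := by
    refine (L2.integrable_inner (𝕜 := ℝ) g (S i v)).congr ?_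
    filter_upwards [hS i v] with x hx
    rw [hx, inner_smul_right]
  have hsum (x : SobolevPair O) : ∑ i, inner ℝ (x.snd i) (S i x.fst) =
      ∫ y in O, ∑ i, φ y i * inner ℝ (x.snd i y) (x.fst y) := by
    rw [integral_finsetSum _ fun i _ ↦ hint _ _ i]
    exact Finset.sum_congr rfl fun i _ ↦ hpair _ _ i
  have hmem := SpaceV.mem_of_isClosed
    (s := {x : SobolevPair O | ∑ i, inner ℝ (x.snd i) (S i x.fst) = 0})
    (isClosed_eq (by fun_prop) continuous_const) ?_ w
  · exact (hsum _).symm.trans hmem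
  · rintro x ⟨ψ, hψ, hx, hx'⟩
    rw [Set.mem_ofPred_eq, hsum, ← hφ.integral_convection_eq_zero hψ]
    refine integral_congr_ae ?_
    filter_upwards [hx, ae_all_iff.2 hx'] with y h1 h2
    simp_rw [h1, h2]

/-- `b(z, w, w) = 0` for `z` in the closure of the test fields in `L^p`, `p ≥ 4`, and
`w ∈ 𝕍 ∩ L⁴`. Here `w` is fixed and only `z` is approximated, so that `z` and `w` need no common
approximating sequence. -/
theorem convectionL_solenoidal_eq_zero [IsFiniteMeasure (volume.restrict O)] {p : ℝ≥0∞}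
    [Fact (1 ≤ p)] (hp : 4 ≤ p) {z : VecLp O p} (hz : z ∈ solenoidalLp O p) {w : SpaceV O}
    {c : VecLp O 4} (hc : c =ᵐ[volume.restrict O] w.val) :
    convectionL O (lpInclusion hp z) (SpaceV.gradL w) c = 0 := by
  have hcl : IsClosed {z : VecLp O p | convectionL O (lpInclusion hp z) (SpaceV.gradL w) c = 0} :=
    isClosed_eq (by fun_prop) continuous_const
  rw [← SetLike.mem_coe, solenoidalLp_eq_closure] at hz
  refine closure_minimal ?_ hcl hz
  rintro z ⟨φ, hφ, hzφ⟩
  rw [Set.mem_ofPred_eq, convectionL_eq_integral, ← hφ.integral_convection_spaceV_eq_zero w]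
  refine integral_congr_ae ?_
  filter_upwards [coeFn_lpInclusion hp z, hzφ, hc] with x h1 h2 h3
  rw [h1, h2, h3]
  rfl

end Convection

/-! ### The absorption term -/

section Absorption

lemma rpow_sub_rpow_mul_le {s t α : ℝ} (hs : 0 ≤ s) (hst : s ≤ t) (hα : 1 ≤ α) :
    (t ^ α - s ^ α) * t ≤ α * t ^ α * (t - s) := by
  rcases (hs.trans hst).eq_or_lt with ht | ht
  · obtain rfl : s = 0 := le_antisymm (ht ▸ hst) hs
    simp [← ht]
  have h := one_add_mul_self_le_rpow_one_add (s := s / t - 1) (by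
    have : 0 ≤ s / t := by positivity
    linarith) hα
  rw [add_sub_cancel, Real.div_rpow hs ht.le, le_div_iff₀ (by positivity)] at h
  have h2 : (1 + α * (s / t - 1)) * t ^ α * t = t ^ α * t - α * t ^ α * (t - s) := by
    field_simp
    ring
  nlinarith [mul_le_mul_of_nonneg_right h ht.le]

variable {E : Type*} [NormedAddCommGroup E]

lemma norm_rpow_smul_sub_le [NormedSpace ℝ E] {α : ℝ} (hα : 1 ≤ α) (x y : E) :
    ‖‖x‖ ^ α • x - ‖y‖ ^ α • y‖ ≤ (1 + α) * (‖x‖ ^ α + ‖y‖ ^ α) * ‖x - y‖ := by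
  have key : |‖x‖ ^ α - ‖y‖ ^ α| * ‖y‖ ≤ α * (‖x‖ ^ α + ‖y‖ ^ α) * ‖x - y‖ := by
    have hxy : |‖x‖ - ‖y‖| ≤ ‖x - y‖ := abs_norm_sub_norm_le x y
    have hx0 : 0 ≤ ‖x‖ ^ α := by positivity
    have hy0 : 0 ≤ ‖y‖ ^ α := by positivity
    rcases le_total ‖y‖ ‖x‖ with h | h
    · have hp : ‖y‖ ^ α ≤ ‖x‖ ^ α := by gcongr
      rw [abs_of_nonneg (sub_nonneg.2 h)] at hxy
      rw [abs_of_nonneg (sub_nonneg.2 hp)]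
      calc (‖x‖ ^ α - ‖y‖ ^ α) * ‖y‖ ≤ (‖x‖ ^ α - ‖y‖ ^ α) * ‖x‖ :=
            mul_le_mul_of_nonneg_left h (sub_nonneg.2 hp)
        _ ≤ α * ‖x‖ ^ α * (‖x‖ - ‖y‖) := rpow_sub_rpow_mul_le (norm_nonneg y) h hα
        _ ≤ α * (‖x‖ ^ α + ‖y‖ ^ α) * ‖x - y‖ := by
            gcongr
            linarith
    · have hp : ‖x‖ ^ α ≤ ‖y‖ ^ α := by gcongr
      rw [abs_of_nonpos (sub_nonpos.2 h), neg_sub] at hxy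
      rw [abs_of_nonpos (sub_nonpos.2 hp), neg_sub]
      calc (‖y‖ ^ α - ‖x‖ ^ α) * ‖y‖ ≤ α * ‖y‖ ^ α * (‖y‖ - ‖x‖) :=
            rpow_sub_rpow_mul_le (norm_nonneg x) h hα
        _ ≤ α * (‖x‖ ^ α + ‖y‖ ^ α) * ‖x - y‖ := by
            gcongr
            linarith
  have hdec : ‖x‖ ^ α • x - ‖y‖ ^ α • y = ‖x‖ ^ α • (x - y) + (‖x‖ ^ α - ‖y‖ ^ α) • y := by
    rw [smul_sub, sub_smul]; abel
  rw [hdec]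
  refine (norm_add_le _ _).trans ?_
  rw [norm_smul, norm_smul, Real.norm_eq_abs, Real.norm_eq_abs, abs_of_nonneg (by positivity)]
  have : 0 ≤ ‖y‖ ^ α * ‖x - y‖ := by positivity
  linarith

variable {Ω : Type*} {m : MeasurableSpace Ω} {ν : Measure Ω} {r : ℝ}

lemma absorptionExp_toReal (hr : 0 ≤ r) : (absorptionExp r).toReal = 1 + r := by
  rw [ENNReal.toReal_add (by simp) (by simp), ENNReal.toReal_ofReal hr, ENNReal.toReal_one]

lemma absorptionExp_ne_top (r : ℝ) : absorptionExp r ≠ ⊤ := by simp [absorptionExp]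

/-- Hölder's inequality for `|a|^{r-1} |b| |c|`, with `a, b, c ∈ L^{r+1}`. -/
lemma lintegral_rpow_mul_mul_le (hr : 1 ≤ r) (a b c : Lp E (absorptionExp r) ν) :
    ∫⁻ x, ‖a x‖ₑ ^ (r - 1) * ‖b x‖ₑ * ‖c x‖ₑ ∂ν ≤ ‖a‖ₑ ^ (r - 1) * ‖b‖ₑ * ‖c‖ₑ := by
  have hP : 0 < 1 + r := by linarith
  have h := ENNReal.lintegral_prod_norm_pow_le (μ := ν) (Finset.univ : Finset (Fin 3))
    (f := ![fun x ↦ ‖a x‖ₑ ^ (1 + r), fun x ↦ ‖b x‖ₑ ^ (1 + r), fun x ↦ ‖c x‖ₑ ^ (1 + r)])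
    (p := ![(r - 1) / (1 + r), 1 / (1 + r), 1 / (1 + r)]) (by
      have (f : Lp E (absorptionExp r) ν) : AEMeasurable (fun x ↦ ‖f x‖ₑ ^ (1 + r)) ν :=
        (Lp.aestronglyMeasurable f).enorm.pow_const _
      intro i _
      fin_cases i
      exacts [this a, this b, this c])
    (by simp [Fin.sum_univ_three]; field_simp; ring)
    (by
      intro i _
      fin_cases i
      · exact div_nonneg (by linarith) hP.le
      · exact div_nonneg zero_le_one hP.le
      · exact div_nonneg zero_le_one hP.le)
  have hnorm (f : Lp E (absorptionExp r) ν) :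
      (∫⁻ x, ‖f x‖ₑ ^ (1 + r) ∂ν) ^ (1 / (1 + r)) = ‖f‖ₑ := by
    rw [Lp.enorm_def, eLpNorm_eq_lintegral_rpow_enorm_toReal (by simp [absorptionExp])
      (absorptionExp_ne_top r), absorptionExp_toReal (by linarith)]
  have hnorm' (f : Lp E (absorptionExp r) ν) :
      (∫⁻ x, ‖f x‖ₑ ^ (1 + r) ∂ν) ^ ((r - 1) / (1 + r)) = ‖f‖ₑ ^ (r - 1) := by
    rw [← hnorm, ← ENNReal.rpow_mul, div_eq_mul_one_div, mul_comm]
  have hcancel (u : ℝ≥0∞) (s : ℝ) : (u ^ (1 + r)) ^ (s / (1 + r)) = u ^ s := by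
    rw [← ENNReal.rpow_mul, mul_div_cancel₀ _ hP.ne']
  simp only [Fin.prod_univ_three, Matrix.cons_val_zero, Matrix.cons_val_one, Matrix.cons_val,
    hcancel, hnorm, hnorm', ENNReal.rpow_one] at h
  exact h

lemma integrable_rpow_mul_mul (hr : 1 ≤ r) (a b c : Lp E (absorptionExp r) ν) :
    Integrable (fun x ↦ ‖a x‖ ^ (r - 1) * ‖b x‖ * ‖c x‖) ν := by
  have hm : AEStronglyMeasurable (fun x ↦ ‖a x‖ ^ (r - 1) * ‖b x‖ * ‖c x‖) ν :=
    ((((Lp.aestronglyMeasurable a).norm.aemeasurable.pow_const _).mul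
      (Lp.aestronglyMeasurable b).norm.aemeasurable).mul
      (Lp.aestronglyMeasurable c).norm.aemeasurable).aestronglyMeasurable
  refine ⟨hm, ?_⟩
  refine lt_of_le_of_lt (le_of_eq ?_) ((lintegral_rpow_mul_mul_le hr a b c).trans_lt ?_)
  · refine lintegral_congr fun x ↦ ?_
    rw [enorm_mul, enorm_mul, enorm_norm, enorm_norm,
      Real.enorm_rpow_of_nonneg (norm_nonneg _) (by linarith), enorm_norm]
  · exact ENNReal.mul_lt_top (ENNReal.mul_lt_top
      (ENNReal.rpow_lt_top_of_nonneg (by linarith) enorm_ne_top) enorm_lt_top) enorm_lt_top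

lemma integral_rpow_mul_mul_le (hr : 1 ≤ r) (a b c : Lp E (absorptionExp r) ν) :
    ∫ x, ‖a x‖ ^ (r - 1) * ‖b x‖ * ‖c x‖ ∂ν ≤ ‖a‖ ^ (r - 1) * ‖b‖ * ‖c‖ := by
  have hi := integrable_rpow_mul_mul hr a b c
  rw [integral_eq_lintegral_of_nonneg_ae (ae_of_all _ fun x ↦ by positivity) hi.1]
  have h1 : ∫⁻ x, ENNReal.ofReal (‖a x‖ ^ (r - 1) * ‖b x‖ * ‖c x‖) ∂ν =
      ∫⁻ x, ‖a x‖ₑ ^ (r - 1) * ‖b x‖ₑ * ‖c x‖ₑ ∂ν := by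
    refine lintegral_congr fun x ↦ ?_
    rw [← Real.enorm_of_nonneg (by positivity), enorm_mul, enorm_mul, enorm_norm, enorm_norm,
      Real.enorm_rpow_of_nonneg (norm_nonneg _) (by linarith), enorm_norm]
  have h2 : ‖a‖ₑ ^ (r - 1) * ‖b‖ₑ * ‖c‖ₑ = ENNReal.ofReal (‖a‖ ^ (r - 1) * ‖b‖ * ‖c‖) := by
    rw [← Real.enorm_of_nonneg (by positivity), enorm_mul, enorm_mul, enorm_norm, enorm_norm,
      Real.enorm_rpow_of_nonneg (norm_nonneg _) (by linarith), enorm_norm]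
  rw [h1]
  refine ENNReal.toReal_le_of_le_ofReal (by positivity) ?_
  rw [← h2]
  exact lintegral_rpow_mul_mul_le hr a b c

variable [InnerProductSpace ℝ E]

lemma integrable_absorption (hr : 1 ≤ r) (a b : Lp E (absorptionExp r) ν) :
    Integrable (fun x ↦ ‖a x‖ ^ (r - 1) * inner ℝ (a x) (b x)) ν := by
  refine (integrable_rpow_mul_mul hr a a b).mono ?_ (ae_of_all _ fun x ↦ ?_)
  · exact ((Lp.aestronglyMeasurable a).norm.aemeasurable.pow_const _).aestronglyMeasurable.mul
      ((Lp.aestronglyMeasurable a).inner (Lp.aestronglyMeasurable b))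
  · refine le_trans ?_ (Real.le_norm_self _)
    rw [norm_mul, Real.norm_of_nonneg (Real.rpow_nonneg (norm_nonneg _) _), mul_assoc]
    gcongr
    exact norm_inner_le_norm _ _

/-- The functional `b ↦ ∫ |a|^{r-1} a · b` on `L^{r+1}`. -/
def absorptionL (hr : 1 ≤ r) (a : Lp E (absorptionExp r) ν) :
    StrongDual ℝ (Lp E (absorptionExp r) ν) :=
  LinearMap.mkContinuous
    { toFun := fun b ↦ ∫ x, ‖a x‖ ^ (r - 1) * inner ℝ (a x) (b x) ∂ν
      map_add' := fun b c ↦ by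
        rw [← integral_add (integrable_absorption hr a b) (integrable_absorption hr a c)]
        refine integral_congr_ae ?_
        filter_upwards [Lp.coeFn_add b c] with x hx
        rw [hx, Pi.add_apply, inner_add_right, mul_add]
      map_smul' := fun k b ↦ by
        rw [RingHom.id_apply, smul_eq_mul, ← integral_const_mul]
        refine integral_congr_ae ?_
        filter_upwards [Lp.coeFn_smul k b] with x hx
        rw [hx, Pi.smul_apply, inner_smul_right, mul_left_comm] }
    (‖a‖ ^ (r - 1) * ‖a‖) fun b ↦ by
      refine le_trans ?_ (integral_rpow_mul_mul_le hr a a b)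
      refine norm_integral_le_of_norm_le (integrable_rpow_mul_mul hr a a b)
        (ae_of_all _ fun x ↦ ?_)
      rw [norm_mul, Real.norm_of_nonneg (by positivity), mul_assoc]
      gcongr
      exact norm_inner_le_norm _ _

lemma absorptionL_apply (hr : 1 ≤ r) (a b : Lp E (absorptionExp r) ν) :
    absorptionL hr a b = ∫ x, ‖a x‖ ^ (r - 1) * inner ℝ (a x) (b x) ∂ν := rfl

lemma norm_absorptionL_le (hr : 1 ≤ r) (a : Lp E (absorptionExp r) ν) :
    ‖absorptionL hr a‖ ≤ ‖a‖ ^ r := by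
  refine (LinearMap.mkContinuous_norm_le _ (by positivity) _).trans_eq ?_
  rw [← Real.rpow_add_one' (norm_nonneg a) (by linarith), sub_add_cancel]

lemma norm_absorptionL_sub_le (hr : 2 ≤ r) (a b : Lp E (absorptionExp r) ν) :
    ‖absorptionL (one_le_two.trans hr) a - absorptionL (one_le_two.trans hr) b‖ ≤
      r * (‖a‖ ^ (r - 1) + ‖b‖ ^ (r - 1)) * ‖a - b‖ := by
  have hr1 : 1 ≤ r := one_le_two.trans hr
  refine ContinuousLinearMap.opNorm_le_bound _ (by positivity) fun c ↦ ?_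
  rw [sub_apply, absorptionL_apply, absorptionL_apply,
    ← integral_sub (integrable_absorption hr1 a c) (integrable_absorption hr1 b c)]
  have hia := integrable_rpow_mul_mul hr1 a (a - b) c
  have hib := integrable_rpow_mul_mul hr1 b (a - b) c
  refine (norm_integral_le_of_norm_le ((hia.add hib).const_mul r) ?_).trans ?_
  · filter_upwards [Lp.coeFn_sub a b] with x hx
    have h1 : ‖a x‖ ^ (r - 1) * inner ℝ (a x) (c x) - ‖b x‖ ^ (r - 1) * inner ℝ (b x) (c x) =
        inner ℝ (‖a x‖ ^ (r - 1) • a x - ‖b x‖ ^ (r - 1) • b x) (c x) := by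
      rw [inner_sub_left, inner_smul_left, inner_smul_left]
      rfl
    rw [h1, Pi.add_apply, hx, Pi.sub_apply]
    refine (norm_inner_le_norm _ _).trans ?_
    calc _ ≤ ((1 + (r - 1)) * (‖a x‖ ^ (r - 1) + ‖b x‖ ^ (r - 1)) * ‖a x - b x‖) * ‖c x‖ := by
          gcongr
          exact norm_rpow_smul_sub_le (by linarith) _ _
      _ = _ := by ring
  · simp only [Pi.add_apply]
    rw [integral_const_mul, integral_add hia hib]
    have ha := integral_rpow_mul_mul_le hr1 a (a - b) c
    have hb := integral_rpow_mul_mul_le hr1 b (a - b) c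
    calc _ ≤ r * (‖a‖ ^ (r - 1) * ‖a - b‖ * ‖c‖ + ‖b‖ ^ (r - 1) * ‖a - b‖ * ‖c‖) := by
          gcongr
      _ = _ := by ring

lemma continuous_of_norm_sub_le {X Y : Type*} [SeminormedAddCommGroup X]
    [SeminormedAddCommGroup Y] {F : X → Y} {G : X → X → ℝ} (hF : ∀ a b, ‖F b - F a‖ ≤ G a b)
    (hG : ∀ a, Tendsto (G a) (𝓝 a) (𝓝 0)) : Continuous F := by
  rw [continuous_iff_continuousAt]
  intro a
  rw [ContinuousAt, tendsto_iff_norm_sub_tendsto_zero]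
  exact squeeze_zero (fun _ ↦ norm_nonneg _) (hF a) (hG a)

lemma continuous_absorptionL (hr : 2 ≤ r) :
    Continuous (absorptionL (E := E) (ν := ν) (one_le_two.trans hr)) := by
  refine continuous_of_norm_sub_le (Y := StrongDual ℝ (Lp E (absorptionExp r) ν))
    (fun a b ↦ norm_absorptionL_sub_le hr b a) fun a ↦ ?_
  have hc : Continuous fun b : Lp E (absorptionExp r) ν ↦
      r * (‖b‖ ^ (r - 1) + ‖a‖ ^ (r - 1)) * ‖b - a‖ :=
    (continuous_const.mul ((continuous_norm.rpow_const fun _ ↦ Or.inr (by linarith)).add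
      continuous_const)).mul (by fun_prop)
  simpa using hc.tendsto a

end Absorption

/-! ### Coercivity of the difference operator -/

section Coercivity

/-- Young's inequality in the form in which `η` enters. For `r > 3`, `x = s²` is compared with the
tangent of `x ↦ x^{(r-1)/2}` at `x₀ = (2/(βμ(r-1)))^{2/(r-3)}`. -/
lemma sq_div_le_rpow_add_cbfEta {μ β r s : ℝ} (hμ : 0 < μ) (hβ : 0 < β) (hs : 0 ≤ s)
    (hr : 3 < r ∨ (r = 3 ∧ 1 / (2 * β) ≤ μ)) :
    s ^ 2 / (2 * μ) ≤ β * s ^ (r - 1) + cbfEta μ β r := by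
  rcases hr with hr | ⟨rfl, hr⟩
  · have hr1 : 0 < r - 1 := by linarith
    have hr3 : 0 < r - 3 := by linarith
    rw [cbfEta, if_neg hr.ne']
    set k := 2 / (β * μ * (r - 1)) with hk
    have hk0 : 0 < k := by positivity
    set x₀ := k ^ (2 / (r - 3)) with hx₀
    have hx0 : 0 < x₀ := by positivity
    set p := (r - 1) / 2 with hp
    have hpow : x₀ ^ p = k * x₀ := by
      have h1 : p = (r - 3) / 2 + 1 := by rw [hp]; ring
      have h2 : x₀ ^ ((r - 3) / 2) = k := by
        rw [hx₀, ← Real.rpow_mul hk0.le, show 2 / (r - 3) * ((r - 3) / 2) = 1 by field_simp,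
          Real.rpow_one]
      rw [h1, Real.rpow_add hx0, h2, Real.rpow_one]
    have hsp : s ^ (r - 1) = (s ^ 2) ^ p := by
      rw [← Real.rpow_natCast, ← Real.rpow_mul hs]
      congr 1
      rw [hp]
      push_cast
      ring
    have hb := one_add_mul_self_le_rpow_one_add (s := s ^ 2 / x₀ - 1) (p := p) (by
      have : 0 ≤ s ^ 2 / x₀ := by positivity
      linarith) (by rw [hp]; linarith)
    rw [add_sub_cancel, Real.div_rpow (by positivity) hx0.le, hpow, le_div_iff₀ (by positivity)]
      at hb
    have hb' : k * x₀ + p * k * (s ^ 2 - x₀) ≤ s ^ (r - 1) := by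
      rw [hsp]
      refine le_trans (le_of_eq ?_) hb
      field_simp
    have hpk : β / 2 * (p * k) = 1 / (2 * μ) := by
      rw [hp, hk]
      field_simp
    have hk1 : β / 2 * k = 1 / (μ * (r - 1)) := by
      rw [hk]
      field_simp
    have h0 : 0 ≤ s ^ (r - 1) := by positivity
    have h3 : β / 2 * (k * x₀ + p * k * (s ^ 2 - x₀)) ≤ β / 2 * s ^ (r - 1) := by gcongr
    have h4 : β / 2 * (k * x₀ + p * k * (s ^ 2 - x₀)) =
        s ^ 2 / (2 * μ) - (r - 3) / (2 * μ * (r - 1)) * x₀ := by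
      calc β / 2 * (k * x₀ + p * k * (s ^ 2 - x₀))
          = (β / 2 * k) * x₀ + (β / 2 * (p * k)) * (s ^ 2 - x₀) := by ring
        _ = _ := by
          rw [hpk, hk1]
          field_simp
          ring
    nlinarith
  · rw [cbfEta, if_pos rfl, add_zero, show (3 : ℝ) - 1 = (2 : ℕ) by norm_num, Real.rpow_natCast,
      div_eq_inv_mul]
    gcongr
    rw [div_le_iff₀ (by positivity)] at hr
    rw [inv_le_iff_one_le_mul₀ (by positivity)]
    linarith

/-- Quantitative monotonicity of `x ↦ |x|^α x`: the defect in the inequality is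
`(|x|^α - |y|^α) (|x|² - |y|²) / 2`. -/
lemma half_mul_norm_sub_sq_le_inner {E : Type*} [NormedAddCommGroup E] [InnerProductSpace ℝ E]
    {α : ℝ} (hα : 0 ≤ α) (x y : E) :
    1 / 2 * (‖x‖ ^ α + ‖y‖ ^ α) * ‖x - y‖ ^ 2 ≤
      ‖x‖ ^ α * inner ℝ x (x - y) - ‖y‖ ^ α * inner ℝ y (x - y) := by
  have h : 0 ≤ (‖x‖ ^ α - ‖y‖ ^ α) * (‖x‖ ^ 2 - ‖y‖ ^ 2) := by
    rcases le_total ‖x‖ ‖y‖ with h | h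
    · refine mul_nonneg_of_nonpos_of_nonpos (sub_nonpos.2 ?_) (sub_nonpos.2 ?_) <;> gcongr
    · refine mul_nonneg (sub_nonneg.2 ?_) (sub_nonneg.2 ?_) <;> gcongr
  rw [norm_sub_sq_real, inner_sub_right, inner_sub_right, real_inner_self_eq_norm_sq,
    real_inner_self_eq_norm_sq, real_inner_comm x y]
  linarith

variable {n : ℕ} {μ β r : ℝ}

/-- The pointwise form of coercivity, `x` and `y` being the values of the two fields and `g` the
gradient of their difference. Half of the viscosity absorbs `g` and leaves
`|(x + y)/2|² |x - y|² / (2μ)`, which the absorption and `η |x - y|²` dominate. -/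
lemma pointwise_coercive (hμ : 0 < μ) (hβ : 0 < β) (hr : 3 < r ∨ (r = 3 ∧ 1 / (2 * β) ≤ μ))
    (x y : EuclideanSpace ℝ (Fin n)) (g : Fin n → EuclideanSpace ℝ (Fin n)) :
    0 ≤ μ / 2 * ∑ i, ‖g i‖ ^ 2 + cbfEta μ β r * ‖x - y‖ ^ 2 -
      ∑ i, (x - y) i * inner ℝ (g i) ((1 / 2 : ℝ) • (x + y)) +
      β * (‖x‖ ^ (r - 1) * inner ℝ x (x - y) - ‖y‖ ^ (r - 1) * inner ℝ y (x - y)) := by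
  have hr1 : 0 ≤ r - 1 := by rcases hr with h | ⟨h, -⟩ <;> linarith
  set v := (1 / 2 : ℝ) • (x + y)
  have hv : ‖v‖ ^ 2 ≤ (‖x‖ ^ 2 + ‖y‖ ^ 2) / 2 := by
    have h1 := parallelogram_law_with_norm ℝ x y
    have h2 : ‖v‖ ^ 2 = 1 / 4 * ‖x + y‖ ^ 2 := by
      rw [norm_smul, mul_pow]; norm_num
    nlinarith [sq_nonneg ‖x - y‖]
  have hx := sq_div_le_rpow_add_cbfEta hμ hβ (norm_nonneg x) hr
  have hy := sq_div_le_rpow_add_cbfEta hμ hβ (norm_nonneg y) hr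
  have hmono := half_mul_norm_sub_sq_le_inner hr1 x y
  have hterm (i : Fin n) : (x - y) i * inner ℝ (g i) v ≤
      μ / 2 * ‖g i‖ ^ 2 + ‖v‖ ^ 2 / (2 * μ) * (x - y) i ^ 2 := by
    have h1 : (x - y) i * inner ℝ (g i) v ≤ |(x - y) i| * (‖g i‖ * ‖v‖) := by
      refine (le_abs_self _).trans ?_
      rw [abs_mul]
      gcongr
      exact abs_real_inner_le_norm _ _
    have h2 : 0 ≤ (μ * ‖g i‖ - |(x - y) i| * ‖v‖) ^ 2 / (2 * μ) := by positivity
    have h3 : (μ * ‖g i‖ - |(x - y) i| * ‖v‖) ^ 2 / (2 * μ) =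
        μ / 2 * ‖g i‖ ^ 2 + ‖v‖ ^ 2 / (2 * μ) * (x - y) i ^ 2 -
          |(x - y) i| * (‖g i‖ * ‖v‖) := by
      rw [← sq_abs ((x - y) i)]
      field_simp
      ring
    linarith
  have hsum : ∑ i, (x - y) i * inner ℝ (g i) v ≤
      μ / 2 * ∑ i, ‖g i‖ ^ 2 + ‖v‖ ^ 2 / (2 * μ) * ‖x - y‖ ^ 2 := by
    rw [EuclideanSpace.real_norm_sq_eq (x - y), Finset.mul_sum, Finset.mul_sum,
      ← Finset.sum_add_distrib]
    exact Finset.sum_le_sum fun i _ ↦ hterm i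
  have hv2 : ‖v‖ ^ 2 / (2 * μ) ≤
      β * (1 / 2 * (‖x‖ ^ (r - 1) + ‖y‖ ^ (r - 1))) + cbfEta μ β r := by
    calc ‖v‖ ^ 2 / (2 * μ) ≤ ((‖x‖ ^ 2 + ‖y‖ ^ 2) / 2) / (2 * μ) := by gcongr
      _ = (‖x‖ ^ 2 / (2 * μ) + ‖y‖ ^ 2 / (2 * μ)) / 2 := by ring
      _ ≤ _ := by linarith
  have h5 := mul_le_mul_of_nonneg_right hv2 (sq_nonneg ‖x - y‖)
  have h6 := mul_le_mul_of_nonneg_left hmono hβ.le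
  linarith

variable {O : Set (EuclideanSpace ℝ (Fin n))}

lemma four_le_absorptionExp (hr : 3 ≤ r) : 4 ≤ absorptionExp r := by
  have : ENNReal.ofReal 3 ≤ ENNReal.ofReal r := ENNReal.ofReal_le_ofReal hr
  rw [ENNReal.ofReal_ofNat] at this
  calc (4 : ℝ≥0∞) = 1 + 3 := by norm_num
    _ ≤ 1 + ENNReal.ofReal r := add_le_add le_rfl this

set_option maxSynthPendingDepth 3 in
/-- `⟨B(u) - B(v), u - v⟩ = -b(u - v, u - v, (u + v)/2)`. The mean of `u` and `v` appears, rather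
than `v` alone, because `b(w, w, w) = 0`; it lets both halves of the monotonicity of the
absorption be used, which the critical case `2βμ ≥ 1` needs. -/
lemma convectionL_sub_apply_sub [IsFiniteMeasure (volume.restrict O)] (hp : 4 ≤ absorptionExp r)
    {u v : SpaceV O} {zu zv : VecLp O (absorptionExp r)} (hzu : zu ∈ spaceLtilde O r)
    (hzv : zv ∈ spaceLtilde O r) (hu : zu =ᵐ[volume.restrict O] u.val)
    (hv : zv =ᵐ[volume.restrict O] v.val) :
    (convectionL O (lpInclusion hp zu) (SpaceV.gradL u) -
        convectionL O (lpInclusion hp zv) (SpaceV.gradL v))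
      (lpInclusion hp zu - lpInclusion hp zv) =
    -convectionL O (lpInclusion hp zu - lpInclusion hp zv) (SpaceV.gradL (u - v))
      ((1 / 2 : ℝ) • (lpInclusion hp zu + lpInclusion hp zv)) := by
  have hcu : lpInclusion hp zu =ᵐ[volume.restrict O] u.val := (coeFn_lpInclusion hp zu).trans hu
  have hcv : lpInclusion hp zv =ᵐ[volume.restrict O] v.val := (coeFn_lpInclusion hp zv).trans hv
  have hcs : (lpInclusion hp zu + lpInclusion hp zv : VecLp O 4) =ᵐ[volume.restrict O]
      (u + v).val :=
    (Lp.coeFn_add _ _).trans ((hcu.add hcv).trans (Lp.coeFn_add u.val v.val).symm)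
  have h1 := convectionL_solenoidal_eq_zero hp hzu hcu
  have h2 := convectionL_solenoidal_eq_zero hp hzu hcv
  have h3 := convectionL_solenoidal_eq_zero hp hzv hcu
  have h4 := convectionL_solenoidal_eq_zero hp hzv hcv
  have h5 := convectionL_solenoidal_eq_zero hp hzu hcs
  have h6 := convectionL_solenoidal_eq_zero hp hzv hcs
  simp only [map_add, map_sub, map_smul, add_apply, sub_apply, smul_eq_mul] at *
  linarith

/-- Coercivity of `u ↦ μ A u + B(u) + β C(u)` along differences `u - v`. -/
theorem coercive_sub [IsFiniteMeasure (volume.restrict O)] (hμ : 0 < μ) (hβ : 0 < β)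
    (hr : 3 < r ∨ (r = 3 ∧ 1 / (2 * β) ≤ μ)) (hp : 4 ≤ absorptionExp r) (hr1 : 1 ≤ r)
    {u v : SpaceV O} {zu zv : VecLp O (absorptionExp r)} (hzu : zu ∈ spaceLtilde O r)
    (hzv : zv ∈ spaceLtilde O r) (hu : zu =ᵐ[volume.restrict O] u.val)
    (hv : zv =ᵐ[volume.restrict O] v.val) :
    μ / 2 * ‖SpaceV.gradL (u - v)‖ ^ 2 - cbfEta μ β r * ‖(u - v).val‖ ^ 2 ≤
      μ * ‖SpaceV.gradL (u - v)‖ ^ 2 +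
      (convectionL O (lpInclusion hp zu) (SpaceV.gradL u) -
        convectionL O (lpInclusion hp zv) (SpaceV.gradL v))
        (lpInclusion hp zu - lpInclusion hp zv) +
      β * (absorptionL hr1 zu - absorptionL hr1 zv) (zu - zv) := by
  rw [convectionL_sub_apply_sub hp hzu hzv hu hv, sub_apply, absorptionL_apply, absorptionL_apply,
    convectionL_eq_integral]
  set w := u - v
  set cu := lpInclusion hp zu
  set cv := lpInclusion hp zv
  set c := (1 / 2 : ℝ) • (cu + cv)
  have hgrad : ‖SpaceV.gradL w‖ ^ 2 = ∫ x in O, ∑ i, ‖w.grad i x‖ ^ 2 := by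
    rw [PiLp.norm_sq_eq_of_L2, integral_finsetSum _ fun i _ ↦
      (Lp.memLp (w.grad i)).integrable_norm_pow (by norm_num)]
    exact Finset.sum_congr rfl fun i _ ↦ VecLp.norm_sq_eq_integral _
  have i1 : IntegrableOn (fun x ↦ ∑ i, ‖w.grad i x‖ ^ 2) O :=
    integrable_finsetSum _ fun i _ ↦ (Lp.memLp (w.grad i)).integrable_norm_pow (by norm_num)
  have i2 : IntegrableOn (fun x ↦ ‖w.val x‖ ^ 2) O :=
    (Lp.memLp w.val).integrable_norm_pow (by norm_num)
  have i3 : IntegrableOn (fun x ↦ ∑ i, (cu - cv) x i * inner ℝ (SpaceV.gradL w i x) (c x)) O :=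
    integrable_finsetSum _ fun i _ ↦ integrable_convection _ _ _ i
  have i4 := integrable_absorption hr1 zu (zu - zv)
  have i5 := integrable_absorption hr1 zv (zu - zv)
  rw [hgrad, VecLp.norm_sq_eq_integral]
  have hpos : 0 ≤ ∫ x in O, (μ / 2 * ∑ i, ‖w.grad i x‖ ^ 2 + cbfEta μ β r * ‖w.val x‖ ^ 2 -
      ∑ i, (cu - cv) x i * inner ℝ (SpaceV.gradL w i x) (c x) +
      β * (‖zu x‖ ^ (r - 1) * inner ℝ (zu x) ((zu - zv) x) -
        ‖zv x‖ ^ (r - 1) * inner ℝ (zv x) ((zu - zv) x))) := by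
    refine integral_nonneg_of_ae ?_
    filter_upwards [hu, hv, coeFn_lpInclusion hp zu, coeFn_lpInclusion hp zv, Lp.coeFn_sub cu cv,
      Lp.coeFn_add cu cv, Lp.coeFn_smul (1 / 2 : ℝ) (cu + cv), Lp.coeFn_sub zu zv,
      Lp.coeFn_sub u.val v.val] with x h1 h2 h3 h4 h5 h6 h7 h8 h9
    have e1 : (cu - cv) x = zu x - zv x := by rw [h5, Pi.sub_apply, h3, h4]
    have e2 : c x = (1 / 2 : ℝ) • (zu x + zv x) := by
      rw [h7, Pi.smul_apply, h6, Pi.add_apply, h3, h4]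
    have e3 : w.val x = zu x - zv x := by
      rw [h1, h2, ← Pi.sub_apply]; exact h9
    rw [e1, e2, e3, h8, Pi.sub_apply]
    exact pointwise_coercive hμ hβ hr (zu x) (zv x) fun i ↦ w.grad i x
  have i12 : IntegrableOn (fun x ↦ μ / 2 * ∑ i, ‖w.grad i x‖ ^ 2 + cbfEta μ β r * ‖w.val x‖ ^ 2)
      O := (i1.const_mul (μ / 2)).add (i2.const_mul (cbfEta μ β r))
  have hsplit := integral_add (i12.sub i3) ((i4.sub i5).const_mul β)
  simp only [Pi.sub_apply] at hsplit
  rw [hsplit, integral_sub i12 i3,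
    integral_add (i1.const_mul (μ / 2)) (i2.const_mul (cbfEta μ β r)), integral_const_mul,
    integral_const_mul, integral_const_mul, integral_sub i4 i5] at hpos
  linarith

end Coercivity

/-! ### Exponential decay from the integral inequality -/

section Gronwall

/-- Gronwall's inequality in integral form, for a function not assumed differentiable and a rate
`κ` of either sign. -/
lemma le_exp_mul_of_sub_le_integral {y : ℝ → ℝ} (hy : Continuous y) {κ : ℝ}
    (h : ∀ a b : ℝ, 0 < a → a ≤ b → y b - y a ≤ -κ * ∫ t in a..b, y t) {t : ℝ} (ht : 0 ≤ t) :
    y t ≤ Real.exp (-κ * t) * y 0 := by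
  rcases ht.eq_or_lt with rfl | ht
  · simp
  have key (a : ℝ) (ha : a ∈ Set.Ioo 0 t) : y t ≤ y a * Real.exp (-κ * (t - a)) := by
    rw [← gronwallBound_ε0]
    refine le_gronwallBound_of_liminf_deriv_right_le (f' := fun x ↦ -κ * y x) hy.continuousOn
      (fun x hx c hc ↦ ?_) le_rfl (fun x _ ↦ by simp) t (Set.right_mem_Icc.2 ha.2.le)
    have hlim : Tendsto (fun z ↦ (z - x)⁻¹ * (-κ * ∫ s in x..z, y s)) (𝓝[>] x)
        (𝓝 (-κ * y x)) := by
      have h1 := (hy.integral_hasStrictDerivAt x x).hasDerivAt.hasDerivWithinAt (s := Set.Ioi x)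
      rw [hasDerivWithinAt_iff_tendsto_slope' (by simp)] at h1
      refine (h1.const_mul (-κ)).congr fun z ↦ ?_
      simp [slope, mul_left_comm]
    refine ((hlim.eventually_lt_const hc).and self_mem_nhdsWithin).frequently.mono ?_
    rintro z ⟨hz, hxz⟩
    refine lt_of_le_of_lt ?_ hz
    exact mul_le_mul_of_nonneg_left (h x z (ha.1.trans_le hx.1) (le_of_lt hxz))
      (inv_nonneg.2 (sub_nonneg.2 (le_of_lt hxz)))
  have hlim : Tendsto (fun a ↦ y a * Real.exp (-κ * (t - a))) (𝓝[>] 0)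
      (𝓝 (y 0 * Real.exp (-κ * (t - 0)))) :=
    ((by fun_prop : Continuous fun a ↦ y a * Real.exp (-κ * (t - a))).tendsto 0).mono_left
      nhdsWithin_le_nhds
  have := ge_of_tendsto hlim (by filter_upwards [Ioo_mem_nhdsGT ht] with a ha using key a ha)
  rwa [sub_zero, mul_comm] at this

end Gronwall

section Decay

variable {X₁ Y₁ X₂ Y₂ : Type*} [NormedAddCommGroup X₁]
  [NormedSpace ℝ X₁] [NormedAddCommGroup X₂] [NormedSpace ℝ X₂] [NormedAddCommGroup Y₁]
  [NormedSpace ℝ Y₁] [NormedAddCommGroup Y₂] [NormedSpace ℝ Y₂]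

/-- The backward difference inequality, integrated in time, and Gronwall's inequality give
exponential decay as soon as the sum of the two pairings is at most `-κ y`. -/
theorem le_exp_mul_of_backward_difference_le
    (B₁ : X₁ →L[ℝ] Y₁ →L[ℝ] ℝ) (B₂ : X₂ →L[ℝ] Y₂ →L[ℝ] ℝ) {p₁ q₁ p₂ q₂ : ℝ≥0∞}
    [Fact (1 ≤ p₁)] [Fact (1 ≤ q₁)] [Fact (1 ≤ p₂)] [Fact (1 ≤ q₂)]
    [ENNReal.HolderConjugate q₁ p₁] [ENNReal.HolderConjugate q₂ p₂] (hq₁ : q₁ ≠ ⊤) (hq₂ : q₂ ≠ ⊤)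
    {y : ℝ → ℝ} (hy : ContinuousOn y (Set.Ici 0)) {κ : ℝ}
    {g₁ : ℝ → X₁} {z₁ : ℝ → Y₁} {g₂ : ℝ → X₂} {z₂ : ℝ → Y₂}
    (hg₁ : ∀ b : ℝ, 0 < b → MemLp g₁ q₁ (volume.restrict (Set.Ioc 0 b)))
    (hz₁ : ∀ b : ℝ, 0 < b → MemLp z₁ p₁ (volume.restrict (Set.Ioc 0 b)))
    (hg₂ : ∀ b : ℝ, 0 < b → MemLp g₂ q₂ (volume.restrict (Set.Ioc 0 b)))
    (hz₂ : ∀ b : ℝ, 0 < b → MemLp z₂ p₂ (volume.restrict (Set.Ioc 0 b)))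
    (hdiff : ∀ᵐ t ∂(volume.restrict (Set.Ioi (0 : ℝ))), ∀ h : ℝ, 0 < h → h < t →
      y t - y (t - h) ≤
        (∫ s in (t - h)..t, B₁ (g₁ s) (z₁ t)) + ∫ s in (t - h)..t, B₂ (g₂ s) (z₂ t))
    (hle : ∀ᵐ t ∂(volume.restrict (Set.Ioi (0 : ℝ))),
      B₁ (g₁ t) (z₁ t) + B₂ (g₂ t) (z₂ t) ≤ -κ * y t) {t : ℝ} (ht : 0 ≤ t) :
    y t ≤ Real.exp (-κ * t) * y 0 := by
  -- `y` is continuous on `[0, ∞)` only, hence the `max`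
  have hyc : Continuous fun t ↦ y (max t 0) :=
    hy.comp_continuous (by fun_prop) fun t ↦ Set.mem_Ici.2 (le_max_right _ _)
  suffices h : y (max t 0) ≤ Real.exp (-κ * t) * y (max 0 0) by
    rwa [max_eq_left ht, max_self] at h
  refine le_exp_mul_of_sub_le_integral hyc (fun a b ha hab ↦ ?_) ht
  have hb : 0 < b := ha.trans_le hab
  have hIoc : Set.Ioc a b ⊆ Set.Ioi 0 := fun s hs ↦ ha.trans hs.1
  have henergy := sub_le_integral_of_backward_difference_le B₁ B₂ hq₁ hq₂ hyc ha hab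
    (hg₁ b hb) (hz₁ b hb) (hg₂ b hb) (hz₂ b hb) (by
      intro h hh hha
      filter_upwards [ae_restrict_of_ae_restrict_of_subset hIoc hdiff,
        ae_restrict_mem measurableSet_Ioc] with t ht htab
      rw [max_eq_left (ha.trans htab.1).le, max_eq_left (by linarith [htab.1])]
      exact ht h hh (hha.trans htab.1))
  refine henergy.trans ?_
  have hsub : volume.restrict (Set.Ioc a b) ≤ volume.restrict (Set.Ioc 0 b) :=
    Measure.restrict_mono (Set.Ioc_subset_Ioc_left ha.le) le_rfl
  have hi₁ : IntegrableOn (fun t ↦ B₁ (g₁ t) (z₁ t)) (Set.Ioc a b) :=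
    memLp_one_iff_integrable.1
      (B₁.memLp_of_bilin 1 ((hg₁ b hb).mono_measure hsub) ((hz₁ b hb).mono_measure hsub))
  have hi₂ : IntegrableOn (fun t ↦ B₂ (g₂ t) (z₂ t)) (Set.Ioc a b) :=
    memLp_one_iff_integrable.1
      (B₂.memLp_of_bilin 1 ((hg₂ b hb).mono_measure hsub) ((hz₂ b hb).mono_measure hsub))
  rw [← integral_add hi₁ hi₂, intervalIntegral.integral_of_le hab, ← integral_const_mul]
  refine integral_mono_ae (hi₁.add hi₂) ((hyc.integrableOn_Ioc).const_mul _) ?_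
  filter_upwards [ae_restrict_of_ae_restrict_of_subset hIoc hle,
    ae_restrict_mem measurableSet_Ioc] with t ht htab
  rwa [max_eq_left (ha.trans htab.1).le]

end Decay

/-! ### Weak solutions -/

section WeakSolutions

set_option maxSynthPendingDepth 3

variable {n : ℕ} {O : Set (EuclideanSpace ℝ (Fin n))} {μ β r : ℝ}

/-- The exponent `(r + 1) / r`, conjugate to `r + 1`. -/
def absorptionConjExp (r : ℝ) : ℝ≥0∞ := absorptionExp r / ENNReal.ofReal r

lemma absorptionConjExp_holderConjugate (hr : 0 < r) :
    ENNReal.HolderConjugate (absorptionConjExp r) (absorptionExp r) := by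
  have h0 : ENNReal.ofReal r ≠ 0 := by simpa using hr
  have hp0 : absorptionExp r ≠ 0 := by simp [absorptionExp]
  rw [ENNReal.holderConjugate_iff, absorptionConjExp, ENNReal.inv_div (by simp) (by simp [h0]),
    ← one_div, ← ENNReal.add_div, add_comm]
  exact ENNReal.div_self hp0 (absorptionExp_ne_top r)

lemma absorptionConjExp_ne_top (hr : 0 < r) : absorptionConjExp r ≠ ⊤ :=
  ENNReal.div_ne_top (absorptionExp_ne_top r) (by simpa using hr)

lemma one_le_absorptionConjExp (hr : 0 < r) : 1 ≤ absorptionConjExp r := by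
  rw [absorptionConjExp, ENNReal.le_div_iff_mul_le (Or.inl (by simpa using hr)) (Or.inl (by simp)),
    one_mul]
  exact le_add_self

lemma absorptionConjExp_le (hr : 3 ≤ r) : absorptionConjExp r ≤ (4⁻¹ + 2⁻¹)⁻¹ := by
  have hc := (absorptionConjExp_holderConjugate (by linarith : 0 < r)).inv_add_inv_eq_inv
  rw [ENNReal.le_inv_iff_le_inv]
  have h1 : (absorptionExp r)⁻¹ ≤ 4⁻¹ := ENNReal.inv_le_inv.2 (four_le_absorptionExp hr)
  have h2 : (4 : ℝ≥0∞)⁻¹ + 2⁻¹ + 4⁻¹ = 1 := by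
    have : (4 : ℝ≥0∞)⁻¹ + 4⁻¹ = 2⁻¹ := by
      have := ENNReal.HolderTriple.inv_add_inv_eq_inv 4 4 2
      exact this
    rw [add_right_comm, this, ENNReal.inv_two_add_inv_two]
  rw [inv_one] at hc
  refine (ENNReal.add_le_add_iff_right (a := 4⁻¹) (by simp)).1 ?_
  rw [h2, ← hc]
  gcongr

/-- The nonlinear part `v ↦ ⟨B(u) + β C(u), v⟩` as a functional on `L^{r+1}`; the function `u` is
given by `z`, its gradient by `g`. -/
def nonlinearPart [IsFiniteMeasure (volume.restrict O)] (β : ℝ) (hp : 4 ≤ absorptionExp r)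
    (hr : 1 ≤ r) (z : VecLp O (absorptionExp r)) (g : PiLp 2 (fun _ : Fin n => VecLp O 2)) :
    StrongDual ℝ (VecLp O (absorptionExp r)) :=
  (convectionL O (lpInclusion hp z) g).comp (lpInclusion hp) + β • absorptionL hr z

lemma operator_eq_nonlinearPart [IsFiniteMeasure (volume.restrict O)] (hp : 4 ≤ absorptionExp r)
    (hr : 1 ≤ r) {u v : SpaceV O} {zu zv : VecLp O (absorptionExp r)}
    (hu : zu =ᵐ[volume.restrict O] u.val) (hv : zv =ᵐ[volume.restrict O] v.val) :
    μ * u.stokes v + u.convection v + β * u.absorption r v =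
      μ * inner ℝ (SpaceV.gradL u) (SpaceV.gradL v) +
        nonlinearPart β hp hr zu (SpaceV.gradL u) zv := by
  have h1 : u.absorption r v = absorptionL hr zu zv := by
    rw [absorptionL_apply, SpaceV.absorption]
    refine integral_congr_ae ?_
    filter_upwards [hu, hv] with x h1 h2
    rw [h1, h2]
  rw [SpaceV.convection_eq_convectionL ((coeFn_lpInclusion hp zu).trans hu)
    ((coeFn_lpInclusion hp zv).trans hv), SpaceV.stokes_eq_inner, h1, add_assoc]
  rfl

/-- The nonlinear part of the equation lies in `L^{(r+1)/r}` in time. For the convection,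
`u ∈ L⁴(L⁴)` and `∇u ∈ L²(L²)` give time exponent `4/3 ≥ (r+1)/r`. -/
lemma memLp_nonlinearPart [IsFiniteMeasure (volume.restrict O)] (hr : 3 ≤ r)
    (hp : 4 ≤ absorptionExp r) (hr1 : 1 ≤ r) {τ : Measure ℝ} [IsFiniteMeasure τ]
    {z : ℝ → VecLp O (absorptionExp r)} {g : ℝ → PiLp 2 (fun _ : Fin n => VecLp O 2)}
    (hz : MemLp z (absorptionExp r) τ) (hg : MemLp g 2 τ) :
    MemLp (fun s ↦ nonlinearPart β hp hr1 (z s) (g s)) (absorptionConjExp r) τ := by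
  have : ENNReal.HolderTriple 4 2 (4⁻¹ + 2⁻¹)⁻¹ := ⟨(inv_inv _).symm⟩
  have h0 : MemLp (fun s ↦ lpInclusion hp (z s)) (absorptionExp r) τ :=
    (lpInclusion (E := EuclideanSpace ℝ (Fin n)) (μ := volume.restrict O) hp).comp_memLp' hz
  have h1 : MemLp (fun s ↦ lpInclusion hp (z s)) 4 τ := h0.mono_exponent hp
  have h2 : MemLp (fun s ↦ convectionL O (lpInclusion hp (z s)) (g s)) (4⁻¹ + 2⁻¹)⁻¹ τ :=
    (convectionL O).memLp_of_bilin _ h1 hg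
  have h3 : MemLp (fun s ↦ (convectionL O (lpInclusion hp (z s)) (g s)).comp
      (lpInclusion (E := EuclideanSpace ℝ (Fin n)) (μ := volume.restrict O) hp))
      (absorptionConjExp r) τ :=
    ((ContinuousLinearMap.compL ℝ (VecLp O (absorptionExp r)) (VecLp O 4) ℝ).flip
      (lpInclusion hp)).comp_memLp' (h2.mono_exponent (absorptionConjExp_le hr))
  have h4 : MemLp (fun s ↦ absorptionL hr1 (z s)) (absorptionConjExp r) τ := by
    have h5 := hz.norm_rpow_div (ENNReal.ofReal r)
    refine MemLp.mono' h5 ((continuous_absorptionL (by linarith : 2 ≤ r)).comp_aestronglyMeasurable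
      hz.1) (ae_of_all _ fun s ↦ ?_)
    rw [ENNReal.toReal_ofReal (by linarith)]
    exact norm_absorptionL_le hr1 (z s)
  exact h3.add (h4.const_smul β)

end WeakSolutions

/-! ### The energy inequality for the distance to the stationary solution -/

section EnergyInequality

set_option maxSynthPendingDepth 3

variable {n : ℕ} {O : Set (EuclideanSpace ℝ (Fin n))} {μ β r : ℝ}

/-- The backward difference of the squared distance to the stationary solution, tested with
`u(t) - u∞`. Here `‖w‖² - ‖w'‖² ≤ 2 (w - w', w)`. -/
lemma IsWeakSolution.backward_difference_le [IsFiniteMeasure (volume.restrict O)]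
    {f : StrongDual ℝ (SpaceV O)} {uinf : SpaceV O} {u₀ : spaceH O} {u : ℝ → spaceH O}
    (hr : 3 ≤ r) (hp : 4 ≤ absorptionExp r) (hr1 : 1 ≤ r)
    (hstat : IsStationarySolution O μ β r f uinf)
    {zinf : spaceLtilde O r}
    (hzinf : (zinf : VecLp O (absorptionExp r)) =ᵐ[volume.restrict O] uinf.val)
    {U : ℝ → SpaceV O} {W : ℝ → spaceLtilde O r}
    (hU : ∀ T : ℝ, 0 < T → MemLp U 2 (volume.restrict (Set.Ioc 0 T)))
    (hW : ∀ T : ℝ, 0 < T → MemLp W (absorptionExp r) (volume.restrict (Set.Ioc 0 T)))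
    (hUW : ∀ᵐ t ∂(volume.restrict (Set.Ioi (0 : ℝ))), (U t).val = u t ∧
      (W t : VecLp O (absorptionExp r)) =ᵐ[volume.restrict O] (u t : VecLp O 2))
    (heq : ∀ v : SpaceV O, v.MemLtilde r → ∀ t : ℝ, 0 ≤ t →
      inner ℝ (u t : VecLp O 2) v.val
        + ∫ s in (0 : ℝ)..t, (μ * (U s).stokes v + (U s).convection v
            + β * (U s).absorption r v)
        = inner ℝ (u₀ : VecLp O 2) v.val + t * f v) {t h : ℝ} (hh : 0 < h) (hht : h < t)
    (hUt : (U t).val = u t)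
    (hWt : (W t : VecLp O (absorptionExp r)) =ᵐ[volume.restrict O] (u t : VecLp O 2)) :
    ‖(u t : VecLp O 2) - uinf.val‖ ^ 2 - ‖(u (t - h) : VecLp O 2) - uinf.val‖ ^ 2 ≤
      (∫ s in (t - h)..t, inner ℝ ((-2 * μ) • SpaceV.gradL (U s - uinf))
        (SpaceV.gradL (U t - uinf))) +
      ∫ s in (t - h)..t, ((-2 : ℝ) • (nonlinearPart β hp hr1 (W s) (SpaceV.gradL (U s)) -
        nonlinearPart β hp hr1 zinf (SpaceV.gradL uinf)))
          ((W t : VecLp O (absorptionExp r)) - zinf) := by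
  have ht : 0 < t := hh.trans hht
  set v := U t - uinf
  have hzv : ((W t : VecLp O (absorptionExp r)) - (zinf : VecLp O (absorptionExp r)) :
      VecLp O (absorptionExp r)) =ᵐ[volume.restrict O] v.val := by
    refine (Lp.coeFn_sub _ _).trans (EventuallyEq.trans ?_ (Lp.coeFn_sub (U t).val uinf.val).symm)
    rw [hUt]
    exact hWt.sub hzinf
  have hv : v.MemLtilde r := ⟨W t - zinf, hzv⟩
  set zv : VecLp O (absorptionExp r) :=
    (W t : VecLp O (absorptionExp r)) - (zinf : VecLp O (absorptionExp r))
  set D : ℝ → StrongDual ℝ (VecLp O (absorptionExp r)) := fun s ↦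
    nonlinearPart β hp hr1 (W s) (SpaceV.gradL (U s))
  set Dinf := nonlinearPart β hp hr1 (zinf : VecLp O (absorptionExp r)) (SpaceV.gradL uinf)
  -- integrability of the two parts of the operator on `(0, t]`
  have hUi : IntegrableOn (fun s ↦ inner ℝ (SpaceV.gradL (U s)) (SpaceV.gradL v))
      (Set.Ioc 0 t) :=
    ((SpaceV.gradL.comp_memLp' (hU t ht)).integrable (by norm_num)).inner_const _
  have hDi : IntegrableOn (fun s ↦ D s zv) (Set.Ioc 0 t) := by
    have hW' : MemLp (fun s ↦ (W s : VecLp O (absorptionExp r))) (absorptionExp r)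
        (volume.restrict (Set.Ioc 0 t)) := (spaceLtilde O r).subtypeL.comp_memLp' (hW t ht)
    have := (memLp_nonlinearPart (β := β) hr hp hr1 hW'
      (SpaceV.gradL.comp_memLp' (hU t ht))).integrable (one_le_absorptionConjExp (by linarith))
    exact this.apply_continuousLinearMap zv
  have hAe : ∀ᵐ s ∂(volume.restrict (Set.Ioi (0 : ℝ))),
      μ * (U s).stokes v + (U s).convection v + β * (U s).absorption r v =
        μ * inner ℝ (SpaceV.gradL (U s)) (SpaceV.gradL v) + D s zv := by
    filter_upwards [hUW] with s hs
    exact operator_eq_nonlinearPart hp hr1 (hs.1 ▸ hs.2) hzv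
  have hii (c d : ℝ) (hc : 0 ≤ c) (hcd : c ≤ d) (hd : d ≤ t) :
      IntervalIntegrable (fun s ↦ inner ℝ (SpaceV.gradL (U s)) (SpaceV.gradL v)) volume c d ∧
      IntervalIntegrable (fun s ↦ D s zv) volume c d := by
    rw [intervalIntegrable_iff_integrableOn_Ioc_of_le hcd,
      intervalIntegrable_iff_integrableOn_Ioc_of_le hcd]
    exact ⟨hUi.mono_set (Set.Ioc_subset_Ioc hc hd), hDi.mono_set (Set.Ioc_subset_Ioc hc hd)⟩
  have hA (c : ℝ) (hc : 0 ≤ c) : ∫ s in (0 : ℝ)..c,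
      (μ * (U s).stokes v + (U s).convection v + β * (U s).absorption r v) =
      ∫ s in (0 : ℝ)..c, (μ * inner ℝ (SpaceV.gradL (U s)) (SpaceV.gradL v) + D s zv) := by
    refine intervalIntegral.integral_congr_ae_restrict ?_
    rw [Set.uIoc_of_le hc]
    exact ae_restrict_of_ae_restrict_of_subset Set.Ioc_subset_Ioi_self hAe
  have e1 := heq v hv t ht.le
  have e2 := heq v hv (t - h) (by linarith)
  rw [hA _ ht.le] at e1
  rw [hA _ (by linarith)] at e2
  have h0t := hii 0 t le_rfl ht.le le_rfl
  have h0h := hii 0 (t - h) le_rfl (by linarith) (by linarith)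
  have hht' := hii (t - h) t (by linarith) (by linarith) le_rfl
  have e3 := intervalIntegral.integral_interval_sub_left ((h0t.1.const_mul μ).add h0t.2)
    ((h0h.1.const_mul μ).add h0h.2)
  have e4 := hstat.2 v hv
  rw [operator_eq_nonlinearPart hp hr1 hzinf hzv] at e4
  have e5 : (∫ s in (t - h)..t, inner ℝ ((-2 * μ) • SpaceV.gradL (U s - uinf))
        (SpaceV.gradL v)) + ∫ s in (t - h)..t, ((-2 : ℝ) • (D s - Dinf)) zv =
      -2 * (∫ s in (t - h)..t, (μ * inner ℝ (SpaceV.gradL (U s)) (SpaceV.gradL v) + D s zv)) +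
        2 * (h * f v) := by
    have p1 : ∫ s in (t - h)..t, inner ℝ ((-2 * μ) • SpaceV.gradL (U s - uinf))
        (SpaceV.gradL v) = -2 * μ * ((∫ s in (t - h)..t,
          inner ℝ (SpaceV.gradL (U s)) (SpaceV.gradL v)) -
          h * inner ℝ (SpaceV.gradL uinf) (SpaceV.gradL v)) := by
      simp_rw [inner_smul_left, map_sub, inner_sub_left]
      rw [intervalIntegral.integral_const_mul,
        intervalIntegral.integral_sub hht'.1 intervalIntegrable_const,
        intervalIntegral.integral_const, sub_sub_cancel]
      rfl
    have p2 : ∫ s in (t - h)..t, ((-2 : ℝ) • (D s - Dinf)) zv =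
        -2 * ((∫ s in (t - h)..t, D s zv) - h * Dinf zv) := by
      simp_rw [smul_apply, sub_apply, smul_eq_mul]
      rw [intervalIntegral.integral_const_mul,
        intervalIntegral.integral_sub hht'.2 intervalIntegrable_const,
        intervalIntegral.integral_const, sub_sub_cancel]
      rfl
    rw [p1, p2, intervalIntegral.integral_add (hht'.1.const_mul μ) hht'.2,
      intervalIntegral.integral_const_mul, ← e4]
    ring
  refine le_of_le_of_eq ?_ e5.symm
  have e6 : inner ℝ ((u t : VecLp O 2) - u (t - h)) v.val =
      -(∫ s in (t - h)..t, (μ * inner ℝ (SpaceV.gradL (U s)) (SpaceV.gradL v) + D s zv)) +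
        h * f v := by
    rw [inner_sub_left]
    linarith
  have hvu : v.val = (u t : VecLp O 2) - uinf.val := by
    rw [← hUt]; rfl
  have e7 := norm_sub_sq_real v.val ((u t : VecLp O 2) - u (t - h))
  have e8 : v.val - ((u t : VecLp O 2) - u (t - h)) = (u (t - h) : VecLp O 2) - uinf.val := by
    rw [hvu]; abel
  rw [e8, real_inner_comm, e6] at e7
  rw [← hvu]
  nlinarith [sq_nonneg ‖(u t : VecLp O 2) - u (t - h)‖]

/-- Coercivity of the difference of the two operators, in the form in which it enters the energy
inequality. -/
lemma operator_sub_le [IsFiniteMeasure (volume.restrict O)] (hμ : 0 < μ) (hβ : 0 < β)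
    (hr : 3 < r ∨ (r = 3 ∧ 1 / (2 * β) ≤ μ)) (hp : 4 ≤ absorptionExp r) (hr1 : 1 ≤ r) {ℓ : ℝ}
    (hℓ : ∀ v : SpaceV O, ℓ * ‖v.val‖ ^ 2 ≤ ‖SpaceV.gradL v‖ ^ 2)
    {u v : SpaceV O} {zu zv : VecLp O (absorptionExp r)} (hzu : zu ∈ spaceLtilde O r)
    (hzv : zv ∈ spaceLtilde O r) (hu : zu =ᵐ[volume.restrict O] u.val)
    (hv : zv =ᵐ[volume.restrict O] v.val) :
    inner ℝ ((-2 * μ) • SpaceV.gradL (u - v)) (SpaceV.gradL (u - v)) +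
      ((-2 : ℝ) • (nonlinearPart β hp hr1 zu (SpaceV.gradL u) -
        nonlinearPart β hp hr1 zv (SpaceV.gradL v))) (zu - zv) ≤
      -(ℓ * μ - 2 * cbfEta μ β r) * ‖(u - v).val‖ ^ 2 := by
  have hc := coercive_sub hμ hβ hr hp hr1 hzu hzv hu hv
  have hlow := mul_le_mul_of_nonneg_left (hℓ (u - v)) hμ.le
  have e1 : inner ℝ ((-2 * μ) • SpaceV.gradL (u - v)) (SpaceV.gradL (u - v)) =
      -2 * μ * ‖SpaceV.gradL (u - v)‖ ^ 2 := by
    rw [real_inner_smul_left, real_inner_self_eq_norm_sq]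
  have e2 : ((-2 : ℝ) • (nonlinearPart β hp hr1 zu (SpaceV.gradL u) -
        nonlinearPart β hp hr1 zv (SpaceV.gradL v))) (zu - zv) =
      -2 * ((convectionL O (lpInclusion hp zu) (SpaceV.gradL u) -
        convectionL O (lpInclusion hp zv) (SpaceV.gradL v))
        (lpInclusion hp zu - lpInclusion hp zv) +
      β * (absorptionL hr1 zu - absorptionL hr1 zv) (zu - zv)) := by
    rw [← map_sub (lpInclusion hp) zu zv]
    simp only [nonlinearPart, smul_apply, sub_apply, add_apply,
      ContinuousLinearMap.comp_apply, smul_eq_mul]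
    ring
  rw [e1, e2]
  linarith

/-- Exponential decay of the distance to the stationary solution. -/
theorem IsWeakSolution.norm_sub_sq_le (hO_bdd : Bornology.IsBounded O) (hμ : 0 < μ) (hβ : 0 < β)
    (hr : 3 < r ∨ (r = 3 ∧ 1 / (2 * β) ≤ μ)) {ℓ : ℝ}
    (hℓ : ∀ v : SpaceV O, ℓ * ‖v.val‖ ^ 2 ≤ ‖SpaceV.gradL v‖ ^ 2)
    {f : StrongDual ℝ (SpaceV O)} {uinf : SpaceV O} {u₀ : spaceH O} {u : ℝ → spaceH O}
    (hstat : IsStationarySolution O μ β r f uinf) (hu : IsWeakSolution O μ β r f u₀ u)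
    {t : ℝ} (ht : 0 ≤ t) :
    ‖(u t : VecLp O 2) - uinf.val‖ ^ 2 ≤
      Real.exp (-(ℓ * μ - 2 * cbfEta μ β r) * t) * ‖(u₀ : VecLp O 2) - uinf.val‖ ^ 2 := by
  have : IsFiniteMeasure (volume.restrict O) := ⟨by simpa using hO_bdd.measure_lt_top⟩
  have hr3 : 3 ≤ r := by rcases hr with h | ⟨h, -⟩ <;> linarith
  have hr1 : 1 ≤ r := by linarith
  have hp := four_le_absorptionExp hr3
  obtain ⟨huc, hu0, U, W, hU, hW, hUW, heq⟩ := hu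
  obtain ⟨zinf, hzinf⟩ := hstat.1
  have : Fact (1 ≤ absorptionConjExp r) := ⟨one_le_absorptionConjExp (by linarith)⟩
  have := absorptionConjExp_holderConjugate (r := r) (by linarith)
  have hy : ContinuousOn (fun t ↦ ‖(u t : VecLp O 2) - uinf.val‖ ^ 2) (Set.Ici 0) :=
    ((continuous_subtype_val.comp_continuousOn huc).sub continuousOn_const).norm.pow 2
  have hz₁ (b : ℝ) (hb : 0 < b) : MemLp (fun s ↦ SpaceV.gradL (U s - uinf)) 2
      (volume.restrict (Set.Ioc 0 b)) :=
    SpaceV.gradL.comp_memLp' ((hU b hb).sub (memLp_const uinf))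
  have hW' (b : ℝ) (hb : 0 < b) : MemLp (fun s ↦ (W s : VecLp O (absorptionExp r)))
      (absorptionExp r) (volume.restrict (Set.Ioc 0 b)) :=
    (spaceLtilde O r).subtypeL.comp_memLp' (hW b hb)
  have hg₂ (b : ℝ) (hb : 0 < b) : MemLp (fun s ↦ (-2 : ℝ) •
      (nonlinearPart β hp hr1 (W s) (SpaceV.gradL (U s)) -
        nonlinearPart β hp hr1 zinf (SpaceV.gradL uinf))) (absorptionConjExp r)
      (volume.restrict (Set.Ioc 0 b)) :=
    ((memLp_nonlinearPart (β := β) hr3 hp hr1 (hW' b hb)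
      (SpaceV.gradL.comp_memLp' (hU b hb))).sub (memLp_const _)).const_smul (-2 : ℝ)
  rw [← hu0]
  refine le_exp_mul_of_backward_difference_le
    (X₂ := StrongDual ℝ (VecLp O (absorptionExp r))) (Y₂ := VecLp O (absorptionExp r))
    (y := fun t ↦ ‖(u t : VecLp O 2) - uinf.val‖ ^ 2)
    (innerSL ℝ) (ContinuousLinearMap.id ℝ _) (by norm_num)
    (absorptionConjExp_ne_top (by linarith)) hy (fun b hb ↦ (hz₁ b hb).const_smul (-2 * μ)) hz₁
    hg₂ (fun b hb ↦ (hW' b hb).sub (memLp_const (zinf : VecLp O (absorptionExp r)))) ?_ ?_ ht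
  · filter_upwards [hUW] with t ht h hh hht
    exact IsWeakSolution.backward_difference_le hr3 hp hr1 hstat hzinf hU hW hUW heq hh hht
      ht.1 ht.2
  · filter_upwards [hUW] with t ht
    have hvu : (U t - uinf).val = (u t : VecLp O 2) - uinf.val := by
      rw [← ht.1]; rfl
    have := operator_sub_le hμ hβ hr hp hr1 hℓ (W t).2 zinf.2 (ht.1 ▸ ht.2) hzinf
    rw [hvu] at this
    exact this

end EnergyInequality

end

theorem theorem4p3 {n : ℕ} (hn : 2 ≤ n) (O : Set (EuclideanSpace ℝ (Fin n)))
    (hO : IsOpen O) (hO_ne : O.Nonempty) (hO_bdd : Bornology.IsBounded O)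
    (μ β r : ℝ) (hμ : 0 < μ) (hβ : 0 < β)
    (hcond : (3 < r ∧ 2 * cbfEta μ β r / stokesLambda1 O < μ) ∨
      (r = 3 ∧ 1 / (2 * β) ≤ μ))
    (f : StrongDual ℝ (SpaceV O)) (uinf : SpaceV O)
    (huinf : IsStationarySolution O μ β r f uinf) :
    0 < stokesLambda1 O * μ - 2 * cbfEta μ β r ∧
    IsExponentiallyStable O μ β r f uinf ∧
    ∀ (u₀ : spaceH O) (u : ℝ → spaceH O), IsWeakSolution O μ β r f u₀ u →
      (∀ t : ℝ, 0 ≤ t →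
        ‖(u t : VecLp O 2) - uinf.val‖ ^ 2 ≤
          Real.exp (-(stokesLambda1 O * μ - 2 * cbfEta μ β r) * t) *
            ‖(u₀ : VecLp O 2) - uinf.val‖ ^ 2) ∧
      Tendsto (fun t : ℝ => (u t : VecLp O 2)) atTop (𝓝 uinf.val) := by
  obtain ⟨hl, hP⟩ := SpaceV.stokesLambda1_pos_and_le hn hO hO_ne hO_bdd
  have hκ : 0 < stokesLambda1 O * μ - 2 * cbfEta μ β r := by
    rcases hcond with ⟨-, h⟩ | ⟨rfl, -⟩
    · rw [div_lt_iff₀ hl] at h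
      linarith
    · rw [cbfEta, if_pos rfl]
      simp only [mul_zero, sub_zero]
      positivity
  have hdecay (u₀ : spaceH O) (u : ℝ → spaceH O) (hu : IsWeakSolution O μ β r f u₀ u) (t : ℝ)
      (ht : 0 ≤ t) := hu.norm_sub_sq_le hO_bdd hμ hβ (hcond.imp_left And.left) hP huinf ht
  set κ := stokesLambda1 O * μ - 2 * cbfEta μ β r
  have hexp (u₀ : spaceH O) (u : ℝ → spaceH O) (hu : IsWeakSolution O μ β r f u₀ u) (t : ℝ)
      (ht : 0 ≤ t) : ‖(u t : VecLp O 2) - uinf.val‖ ≤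
        ‖(u₀ : VecLp O 2) - uinf.val‖ * Real.exp (-(κ / 2) * t) := by
    refine (pow_le_pow_iff_left₀ (norm_nonneg _) (by positivity) two_ne_zero).1 ?_
    refine (hdecay u₀ u hu t ht).trans_eq ?_
    rw [mul_pow, ← Real.exp_nat_mul, mul_comm]
    congr 2
    push_cast
    ring
  refine ⟨hκ, ⟨κ / 2, by positivity, hexp⟩, fun u₀ u hu ↦ ⟨hdecay u₀ u hu, ?_⟩⟩
  rw [tendsto_iff_norm_sub_tendsto_zero]
  have hlim : Tendsto (fun t : ℝ ↦ ‖(u₀ : VecLp O 2) - uinf.val‖ * Real.exp (-(κ / 2) * t)) atTop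
      (𝓝 0) := by
    have h1 : Tendsto (fun t : ℝ ↦ -(κ / 2) * t) atTop atBot :=
      tendsto_id.const_mul_atTop_of_neg (by linarith)
    simpa using (Real.tendsto_exp_atBot.comp h1).const_mul ‖(u₀ : VecLp O 2) - uinf.val‖
  refine squeeze_zero' (Eventually.of_forall fun _ ↦ norm_nonneg _) ?_ hlim
  filter_upwards [eventually_ge_atTop 0] with t ht using hexp u₀ u hu t ht
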